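/- Let $(\mathcal M,g)$ be a complete, connected, non-compact, smooth Riemannian manifold without boundary, of dimension $d\ge 2$, let $f\in C^2(\mathcal M)$, and let $\mu$ be the weighted measure $d\mu=e^{-f}\,d\nu$, where $\nu$ is the Riemannian volume measure. Let $\mathcal L w=\Delta w-\nabla f\cdot\nabla w$ be the associated weighted Laplacian (no curvature assumption is made). Let $p>1$ and let $u\in C^3(\mathcal M)$ be a non-negative solution of $$-\mathcal L u=u^p\quad\text{in }\mathcal M .$$ If for some $o\in\mathcal M$ the geodesic balls $\mathcal B_R(o)$ satisfy $$\mu(\mathcal B_R(o))=o\!\left(R^{\frac{2p}{p-1}}\right)\quad\text{as }R\to+\infty ,$$ then $u\equiv 0$ on $\mathcal M$. -/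

import Mathlib

open Bundle Manifold MeasureTheory Filter Topology
open scoped ContDiff ENNReal

noncomputable section

namespace WeightedManifold

/-- The gradient of `w` at `x`: the tangent vector `∇w(x)` representing the differential `dw_x`
with respect to the Riemannian metric. -/
def grad (d : ℕ) {M : Type*} [TopologicalSpace M]
    [ChartedSpace (EuclideanSpace ℝ (Fin d)) M]
    [RiemannianBundle (fun x : M ↦ TangentSpace (𝓡 d) x)]
    (w : M → ℝ) (x : M) : TangentSpace (𝓡 d) x :=
  haveI : FiniteDimensional ℝ (TangentSpace (𝓡 d) x) :=
    inferInstanceAs (FiniteDimensional ℝ (EuclideanSpace ℝ (Fin d)))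
  haveI : CompleteSpace (TangentSpace (𝓡 d) x) := FiniteDimensional.complete ℝ _
  (InnerProductSpace.toDual ℝ (TangentSpace (𝓡 d) x)).symm (mfderiv (𝓡 d) 𝓘(ℝ, ℝ) w x)

/-- The coordinate vector field `∂ᵢ` of the chart `e`, at the point with coordinates `y`. -/
def coordVector {d : ℕ} {M : Type*} [TopologicalSpace M]
    [ChartedSpace (EuclideanSpace ℝ (Fin d)) M]
    (e : OpenPartialHomeomorph M (EuclideanSpace ℝ (Fin d)))
    (y : EuclideanSpace ℝ (Fin d)) (i : Fin d) : TangentSpace (𝓡 d) (e.symm y) :=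
  mfderiv (𝓡 d) (𝓡 d) e.symm y (EuclideanSpace.single i (1 : ℝ))

/-- The matrix `g_{ij} = ⟨∂ᵢ, ∂ⱼ⟩` of the Riemannian metric in the chart `e`, at the point with
coordinates `y`. -/
def metricMatrix {d : ℕ} {M : Type*} [TopologicalSpace M]
    [ChartedSpace (EuclideanSpace ℝ (Fin d)) M]
    [RiemannianBundle (fun x : M ↦ TangentSpace (𝓡 d) x)]
    (e : OpenPartialHomeomorph M (EuclideanSpace ℝ (Fin d)))
    (y : EuclideanSpace ℝ (Fin d)) : Matrix (Fin d) (Fin d) ℝ :=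
  Matrix.of fun i j ↦ inner ℝ (coordVector e y i) (coordVector e y j)

/-- The Riemannian volume density `√(det g)` in the chart `e`. -/
def volDensity {d : ℕ} {M : Type*} [TopologicalSpace M]
    [ChartedSpace (EuclideanSpace ℝ (Fin d)) M]
    [RiemannianBundle (fun x : M ↦ TangentSpace (𝓡 d) x)]
    (e : OpenPartialHomeomorph M (EuclideanSpace ℝ (Fin d)))
    (y : EuclideanSpace ℝ (Fin d)) : ℝ :=
  Real.sqrt (metricMatrix e y).det

/-- The components `(X¹, …, X^d)` of the vector field `X` in the chart `e`, at the point with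
coordinates `y`. -/
def components {d : ℕ} {M : Type*} [TopologicalSpace M]
    [ChartedSpace (EuclideanSpace ℝ (Fin d)) M]
    (e : OpenPartialHomeomorph M (EuclideanSpace ℝ (Fin d)))
    (X : ∀ x : M, TangentSpace (𝓡 d) x)
    (y : EuclideanSpace ℝ (Fin d)) : EuclideanSpace ℝ (Fin d) :=
  mfderiv (𝓡 d) (𝓡 d) e (e.symm y) (X (e.symm y))

/-- The expression `(1 / √(det g)) ∑ᵢ ∂ᵢ (√(det g) Xⁱ)` in the chart `e`, evaluated at `x`. -/
def divergenceInChart {d : ℕ} {M : Type*} [TopologicalSpace M]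
    [ChartedSpace (EuclideanSpace ℝ (Fin d)) M]
    [RiemannianBundle (fun x : M ↦ TangentSpace (𝓡 d) x)]
    (e : OpenPartialHomeomorph M (EuclideanSpace ℝ (Fin d)))
    (X : ∀ x : M, TangentSpace (𝓡 d) x) (x : M) : ℝ :=
  (volDensity e (e x))⁻¹ *
    ∑ i : Fin d, fderiv ℝ (fun y ↦ volDensity e y * components e X y i) (e x)
      (EuclideanSpace.single i (1 : ℝ))

/-- The Riemannian divergence `div X` of a vector field at `x`. It does not depend on the chart
around `x`; the preferred chart at `x` is used. -/
def divergence {d : ℕ} {M : Type*} [TopologicalSpace M]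
    [ChartedSpace (EuclideanSpace ℝ (Fin d)) M]
    [RiemannianBundle (fun x : M ↦ TangentSpace (𝓡 d) x)]
    (X : ∀ x : M, TangentSpace (𝓡 d) x) (x : M) : ℝ :=
  divergenceInChart (chartAt (EuclideanSpace ℝ (Fin d)) x) X x

/-- The Laplace-Beltrami operator `Δw = div (∇w)`. -/
def laplaceBeltrami (d : ℕ) {M : Type*} [TopologicalSpace M]
    [ChartedSpace (EuclideanSpace ℝ (Fin d)) M]
    [RiemannianBundle (fun x : M ↦ TangentSpace (𝓡 d) x)]
    (w : M → ℝ) (x : M) : ℝ :=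
  divergence (fun z ↦ grad d w z) x

/-- The weighted Laplacian `ℒw = Δw - ⟨∇f, ∇w⟩` of the weight `e^{-f}`. -/
def weightedLaplacian (d : ℕ) {M : Type*} [TopologicalSpace M]
    [ChartedSpace (EuclideanSpace ℝ (Fin d)) M]
    [RiemannianBundle (fun x : M ↦ TangentSpace (𝓡 d) x)]
    (f w : M → ℝ) (x : M) : ℝ :=
  laplaceBeltrami d w x - inner ℝ (grad d f x) (grad d w x)

/-- The measure `√(det g) dy` of the chart `e`, transported to the domain of `e` in `M`. -/
def chartVolume {d : ℕ} {M : Type*} [TopologicalSpace M]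
    [ChartedSpace (EuclideanSpace ℝ (Fin d)) M]
    [RiemannianBundle (fun x : M ↦ TangentSpace (𝓡 d) x)] [MeasurableSpace M]
    (e : OpenPartialHomeomorph M (EuclideanSpace ℝ (Fin d))) : Measure M :=
  (((volume : Measure (EuclideanSpace ℝ (Fin d))).restrict e.target).withDensity
    fun y ↦ ENNReal.ofReal (volDensity e y)).map e.symm

/-- The Riemannian volume measure: the least measure on `M` which dominates `√(det g) dy` on the
domain of every chart. As the chart measures agree on overlaps, it is the measure that equals
`√(det g) dy` in every chart. -/
def riemannianVolume (d : ℕ) (M : Type*) [TopologicalSpace M]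
    [ChartedSpace (EuclideanSpace ℝ (Fin d)) M]
    [RiemannianBundle (fun x : M ↦ TangentSpace (𝓡 d) x)] [MeasurableSpace M] : Measure M :=
  ⨆ e ∈ atlas (EuclideanSpace ℝ (Fin d)) M, chartVolume e

/-- The weighted measure `dμ = e^{-f} dν`, where `ν` is the Riemannian volume measure. -/
def weightedMeasure (d : ℕ) {M : Type*} [TopologicalSpace M]
    [ChartedSpace (EuclideanSpace ℝ (Fin d)) M]
    [RiemannianBundle (fun x : M ↦ TangentSpace (𝓡 d) x)] [MeasurableSpace M]
    (f : M → ℝ) : Measure M :=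
  (riemannianVolume d M).withDensity fun x ↦ ENNReal.ofReal (Real.exp (-f x))

end WeightedManifold

end

/-! Write `p = 2 * t + 1`. The equation is tested against `e^{-f} φ^(k+2) Φ(u)`, where `φ` is a
cutoff equal to `1` on the ball of radius `R` and `0` off the ball of radius `2R`, `Φ(s) = 1 + (l s
+ 1)^(-t)` and `l = R^(1/t)`. Since `Φ` decreases, integration by parts produces a negative multiple
of `|∇u|²`, which absorbs the term containing `∇φ`. What remains is of order `φ^k l^(-p) (l u +
1)^(t+1)`. Its power of `u` is below `p`, so it is absorbed by `Φ(u) u^p ≥ u^p` up to a constant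
multiple of `l^(-p) = R^(-2p/(p-1))`. Hence `∫_{B_R} u^p dμ ≤ C R^(-2p/(p-1)) μ(B_{2R})`, which
tends to `0` by the volume hypothesis, and so `u = 0`. Curvature plays no role: the only fact needed
about the distance function is that it is 1-Lipschitz.

The estimate is `exists_integral_le`. It combines the real inequality `exists_pointwise_bound` with
the divergence theorem `integral_divergence_eq_zero` for a vector field multiplied by a compactly
supported Lipschitz function. The latter is reduced by a partition of unity to Euclidean integration
by parts in charts (`integral_divIntegrand_eq_zero`), using the coordinate description of
`riemannianVolume`. Compactness of closed balls comes from `IsRiemannianManifold.properSpace`, and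
the gradient bound on the cutoff from `abs_derivAlong_le`. -/

set_option linter.unusedSectionVars false

/-! ### Compactness of closed balls in complete length spaces. -/

section LengthSpace

/-- In a complete, locally compact metric space in which distances can be subdivided, closed balls
are compact. -/
theorem ProperSpace.of_subdivision {M : Type*} [MetricSpace M] [CompleteSpace M]
    [LocallyCompactSpace M]
    (hM : ∀ (x y : M) (r s : ℝ), 0 < r → 0 < s → dist x y < r + s →
      ∃ z, dist x z < r ∧ dist z y < s) : ProperSpace M := by
  have key : ∀ (o : M) (r : ℝ), IsCompact (Metric.closedBall o r) := by
    intro o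
    by_contra! hne
    obtain ⟨r₀, hr₀⟩ := hne
    set S : Set ℝ := {r | IsCompact (Metric.closedBall o r)} with hS
    have hdown : ∀ {r s : ℝ}, s ∈ S → r ≤ s → r ∈ S := fun hs hrs ↦
      IsCompact.of_isClosed_subset hs Metric.isClosed_closedBall
        (Metric.closedBall_subset_closedBall hrs)
    have h0 : (0 : ℝ) ∈ S := by simp [hS]
    have hbdd : BddAbove S := ⟨r₀, fun s hs ↦ by
      by_contra! h
      exact hr₀ (hdown hs h.le)⟩
    set R := sSup S
    have hR0 : 0 ≤ R := le_csSup hbdd h0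
    -- The supremum is attained: by subdivision every point of the ball of radius `R` is within `ε /
    -- 2` of a compact smaller ball, so the `R`-ball is totally bounded. The case `R = 0` is
    -- separate because subdivision needs positive radii.
    have hRS : R ∈ S := by
      refine isCompact_iff_totallyBounded_isComplete.2
        ⟨?_, Metric.isClosed_closedBall.isComplete⟩
      rcases hR0.eq_or_lt with h | h
      · rw [← h]
        simp
      refine Metric.totallyBounded_iff.2 fun ε hε ↦ ?_
      obtain ⟨r, hrS, hr⟩ : ∃ r ∈ S, max (R - ε / 2) 0 < r :=
        exists_lt_of_lt_csSup ⟨0, h0⟩ (max_lt (by linarith) h)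
      obtain ⟨t, htf, ht⟩ := Metric.totallyBounded_iff.1
        (isCompact_iff_totallyBounded_isComplete.1 hrS).1 (ε / 2) (half_pos hε)
      refine ⟨t, htf, fun y hy ↦ ?_⟩
      obtain ⟨z, hz1, hz2⟩ := hM o y r (ε / 2) ((le_max_right _ _).trans_lt hr) (half_pos hε)
        (by rw [dist_comm]
            exact (Metric.mem_closedBall.1 hy).trans_lt
              (by linarith [(le_max_left (R - ε / 2) 0).trans_lt hr]))
      have hz : z ∈ Metric.closedBall o r := Metric.mem_closedBall.2 (by rw [dist_comm]; exact hz1.le)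
      obtain ⟨i, hi, hzi⟩ := Set.mem_iUnion₂.1 (ht hz)
      refine Set.mem_iUnion₂.2 ⟨i, hi, ?_⟩
      rw [Metric.mem_ball] at hzi ⊢
      linarith [dist_triangle y z i, dist_comm y z]
    -- Local compactness pushes past the supremum: a compact neighbourhood of the `R`-ball contains
    -- a `δ`-thickening of it, hence the ball of radius `R + δ / 2`.
    obtain ⟨K, hK, hRK⟩ := exists_compact_superset hRS
    obtain ⟨δ, hδ, hδK⟩ := hRS.exists_thickening_subset_open isOpen_interior hRK
    have : R + δ / 2 ∈ S := by
      refine hK.of_isClosed_subset Metric.isClosed_closedBall fun y hy ↦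
        interior_subset (hδK (Metric.mem_thickening_iff.2 ?_))
      rcases hR0.eq_or_lt with h | h
      · refine ⟨o, by simp [← h], ?_⟩
        have := Metric.mem_closedBall.1 hy
        linarith
      · obtain ⟨z, hz1, hz2⟩ := hM o y R δ h hδ (by
          rw [dist_comm]
          exact (Metric.mem_closedBall.1 hy).trans_lt (by linarith))
        exact ⟨z, Metric.mem_closedBall.2 (by rw [dist_comm]; exact hz1.le),
          by rwa [dist_comm]⟩
    linarith [le_csSup hbdd this]
  exact ⟨key⟩

end LengthSpace

/-! ### Riemannian manifolds as length spaces. -/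

section Riemannian

variable {E : Type*} [NormedAddCommGroup E] [NormedSpace ℝ E]
  {H : Type*} [TopologicalSpace H] (I : ModelWithCorners ℝ E H)
  {M : Type*} [MetricSpace M] [ChartedSpace H M]
  [RiemannianBundle (fun x : M ↦ TangentSpace I x)]

/-- Take a curve from `x` to `y` of length `L < r + s` and stop it where the distance to `x` equals
some `r'` with `L - s < r' < r`. The part already travelled has length at least `r'`, so the rest
has length at most `L - r' < s`. -/
theorem IsRiemannianManifold.exists_dist_lt_dist_lt [IsRiemannianManifold I M]
    (x y : M) (r s : ℝ) (hr : 0 < r) (hs : 0 < s) (hxy : dist x y < r + s) : ∃ z, dist x z < r ∧ dist z y < s := by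
  by_cases hxr : dist x y < r
  · exact ⟨y, hxr, by simpa using hs⟩
  push Not at hxr
  have h1 : riemannianEDist I x y < ENNReal.ofReal (r + s) := by
    rw [← IsRiemannianManifold.out (I := I), edist_dist]
    exact (ENNReal.ofReal_lt_ofReal_iff (by linarith)).2 hxy
  obtain ⟨γ, h0, h1, hγ, hL⟩ := exists_lt_of_riemannianEDist_lt h1
  set L := (pathELength I γ 0 1).toReal
  have hLtop : pathELength I γ 0 1 ≠ ⊤ := (hL.trans ENNReal.ofReal_lt_top).ne
  have hL' : L < r + s := by
    rw [← ENNReal.toReal_ofReal (by linarith : 0 ≤ r + s)]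
    exact (ENNReal.toReal_lt_toReal hLtop ENNReal.ofReal_ne_top).2 hL
  obtain ⟨r', hr', hr'r⟩ : ∃ r', max (L - s) 0 < r' ∧ r' < r :=
    exists_between (max_lt (by linarith) hr)
  have hcont : ContinuousOn (fun t ↦ dist x (γ t)) (Set.Icc 0 1) :=
    fun t ht ↦ tendsto_const_nhds.dist (hγ.continuousOn t ht)
  have hmem : r' ∈ (fun t ↦ dist x (γ t)) '' Set.Icc 0 1 := by
    refine intermediate_value_Icc zero_le_one hcont ⟨?_, ?_⟩
    · simpa [h0] using ((le_max_right _ _).trans_lt hr').le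
    · simpa [h1] using hr'r.le.trans hxr
  obtain ⟨t, ht, htr⟩ := hmem
  refine ⟨γ t, by simpa using htr.trans_lt hr'r, ?_⟩
  have hadd := pathELength_add (I := I) (γ := γ) ht.1 ht.2
  have hle1 : edist x (γ t) ≤ pathELength I γ 0 t := by
    rw [IsRiemannianManifold.out (I := I)]
    exact riemannianEDist_le_pathELength (hγ.mono (Set.Icc_subset_Icc le_rfl ht.2)) h0 rfl ht.1
  have hle2 : edist (γ t) y ≤ pathELength I γ t 1 := by
    rw [IsRiemannianManifold.out (I := I)]
    exact riemannianEDist_le_pathELength (hγ.mono (Set.Icc_subset_Icc ht.1 le_rfl)) rfl h1 ht.2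
  have hle : edist x (γ t) + edist (γ t) y ≤ pathELength I γ 0 1 := by
    rw [← hadd]
    gcongr
  have := ENNReal.toReal_mono hLtop hle
  rw [ENNReal.toReal_add (edist_ne_top _ _) (edist_ne_top _ _), edist_dist, edist_dist,
    ENNReal.toReal_ofReal dist_nonneg, ENNReal.toReal_ofReal dist_nonneg] at this
  have h3 : L - s < r' := (le_max_left _ _).trans_lt hr'
  simp only at htr
  linarith

/-- The compactness part of the Hopf-Rinow theorem. -/
theorem IsRiemannianManifold.properSpace [IsRiemannianManifold I M]
    [FiniteDimensional ℝ E] [CompleteSpace M] : ProperSpace M :=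
  haveI : LocallyCompactSpace M := Manifold.locallyCompact_of_finiteDimensional I
  ProperSpace.of_subdivision (IsRiemannianManifold.exists_dist_lt_dist_lt I)

end Riemannian

/-! ### Distances along coordinate segments. -/

section Chart

variable {d : ℕ} {M : Type*} [MetricSpace M] [ChartedSpace (EuclideanSpace ℝ (Fin d)) M]
  [IsManifold (𝓡 d) ∞ M] [RiemannianBundle (fun x : M ↦ TangentSpace (𝓡 d) x)]
  [IsRiemannianManifold (𝓡 d) M]
  {e : OpenPartialHomeomorph M (EuclideanSpace ℝ (Fin d))}

/-- The inverse chart maps the segment to a `C¹` curve of speed at most `C` over unit time. This is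
how the metric of `M` is compared with coordinates. -/
theorem dist_symm_le_of_segment (he : e ∈ atlas (EuclideanSpace ℝ (Fin d)) M)
    {y w : EuclideanSpace ℝ (Fin d)} {C : ℝ}
    (hseg : ∀ t ∈ Set.Icc (0 : ℝ) 1, y + t • w ∈ e.target)
    (hC : ∀ t ∈ Set.Icc (0 : ℝ) 1, ‖mfderiv (𝓡 d) (𝓡 d) e.symm (y + t • w) w‖ ≤ C) :
    dist (e.symm y) (e.symm (y + w)) ≤ C := by
  have hC0 : 0 ≤ C := (norm_nonneg _).trans (hC 0 (by simp))
  let η : ℝ → EuclideanSpace ℝ (Fin d) := fun t ↦ y + t • w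
  have hη : ContDiff ℝ 1 η := by fun_prop
  have hsm : ContMDiffOn (𝓡 d) (𝓡 d) 1 e.symm e.target :=
    contMDiffOn_symm_of_mem_maximalAtlas (IsManifold.subset_maximalAtlas he)
  have hγ : ContMDiffOn 𝓘(ℝ, ℝ) (𝓡 d) 1 (e.symm ∘ η) (Set.Icc 0 1) :=
    hsm.comp hη.contMDiff.contMDiffOn hseg
  have hle : riemannianEDist (𝓡 d) (e.symm y) (e.symm (y + w)) ≤
      pathELength (𝓡 d) (e.symm ∘ η) 0 1 :=
    riemannianEDist_le_pathELength hγ (by simp [η]) (by simp [η]) zero_le_one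
  have hlen : pathELength (𝓡 d) (e.symm ∘ η) 0 1 ≤ ENNReal.ofReal C := by
    rw [pathELength_eq_lintegral_mfderiv_Icc]
    calc _ ≤ ∫⁻ t in Set.Icc (0 : ℝ) 1, ENNReal.ofReal C := by
          refine setLIntegral_mono' measurableSet_Icc fun t ht ↦ ?_
          have h1 : MDifferentiableAt (𝓡 d) (𝓡 d) e.symm (η t) :=
            (mdifferentiable_of_mem_atlas he).mdifferentiableAt_symm (hseg t ht)
          have h2 : HasFDerivAt η ((ContinuousLinearMap.toSpanSingleton ℝ w)) t := by
            have := ((hasDerivAt_id t).smul_const w).const_add y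
            simpa [hasDerivAt_iff_hasFDerivAt, η] using this
          have h3 : HasMFDerivAt 𝓘(ℝ, ℝ) (𝓡 d) (e.symm ∘ η) t _ :=
            h1.hasMFDerivAt.comp t h2.hasMFDerivAt
          rw [h3.mfderiv, ← ofReal_norm]
          refine ENNReal.ofReal_le_ofReal ((le_of_eq ?_).trans (hC t ht))
          congr 1
          change mfderiv (𝓡 d) (𝓡 d) e.symm (η t) ((1 : ℝ) • w) = _
          rw [one_smul]
      _ = ENNReal.ofReal C := by simp
  have := hle.trans hlen
  rw [← IsRiemannianManifold.out (I := 𝓡 d), edist_dist] at this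
  exact (ENNReal.ofReal_le_ofReal_iff hC0).1 this

end Chart

/-! ### Calculus in charts: metric matrix, density, gradient components. -/

namespace WeightedManifold

section ChartCalculus

variable {d : ℕ} {M : Type*} [TopologicalSpace M] [ChartedSpace (EuclideanSpace ℝ (Fin d)) M]
  {e e' : OpenPartialHomeomorph M (EuclideanSpace ℝ (Fin d))}

section Smooth

variable [IsManifold (𝓡 d) ∞ M]

theorem mdifferentiableAt_chart_symm (he : e ∈ atlas (EuclideanSpace ℝ (Fin d)) M)
    {y : EuclideanSpace ℝ (Fin d)} (hy : y ∈ e.target) :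
    MDifferentiableAt (𝓡 d) (𝓡 d) e.symm y :=
  (mdifferentiable_of_mem_atlas he).mdifferentiableAt_symm hy

theorem mfderiv_chart_symm_mfderiv (he : e ∈ atlas (EuclideanSpace ℝ (Fin d)) M)
    {y : EuclideanSpace ℝ (Fin d)} (hy : y ∈ e.target) (v : TangentSpace (𝓡 d) (e.symm y)) :
    mfderiv (𝓡 d) (𝓡 d) e.symm y (mfderiv (𝓡 d) (𝓡 d) e (e.symm y) v) = v := by
  have h := (mdifferentiable_of_mem_atlas (I := 𝓡 d) he).symm_comp_deriv (e.map_target hy)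
  rw [e.right_inv hy] at h
  exact congrArg (fun T ↦ T v) h

theorem mfderiv_mfderiv_chart_symm (he : e ∈ atlas (EuclideanSpace ℝ (Fin d)) M)
    {y : EuclideanSpace ℝ (Fin d)} (hy : y ∈ e.target) (v : EuclideanSpace ℝ (Fin d)) :
    mfderiv (𝓡 d) (𝓡 d) e (e.symm y) (mfderiv (𝓡 d) (𝓡 d) e.symm y v) = v := by
  have h := (mdifferentiable_of_mem_atlas (I := 𝓡 d) he).comp_symm_deriv hy
  exact congrArg (fun T ↦ T v) h

theorem mfderiv_chart_symm_components (he : e ∈ atlas (EuclideanSpace ℝ (Fin d)) M)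
    (X : ∀ x : M, TangentSpace (𝓡 d) x)
    {y : EuclideanSpace ℝ (Fin d)} (hy : y ∈ e.target) :
    mfderiv (𝓡 d) (𝓡 d) e.symm y (components e X y) = X (e.symm y) :=
  mfderiv_chart_symm_mfderiv he hy _

theorem fderiv_comp_chart_symm (he : e ∈ atlas (EuclideanSpace ℝ (Fin d)) M)
    {y : EuclideanSpace ℝ (Fin d)} (hy : y ∈ e.target) {w : M → ℝ}
    (hw : MDifferentiableAt (𝓡 d) 𝓘(ℝ, ℝ) w (e.symm y)) (v : EuclideanSpace ℝ (Fin d)) :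
    fderiv ℝ (w ∘ e.symm) y v =
      mfderiv (𝓡 d) 𝓘(ℝ, ℝ) w (e.symm y) (mfderiv (𝓡 d) (𝓡 d) e.symm y v) := by
  rw [← mfderiv_eq_fderiv, mfderiv_comp y hw (mdifferentiableAt_chart_symm he hy)]
  rfl

theorem mdifferentiableAt_of_comp_chart_symm (he : e ∈ atlas (EuclideanSpace ℝ (Fin d)) M)
    {y : EuclideanSpace ℝ (Fin d)} (hy : y ∈ e.target) {w : M → ℝ}
    (hw : DifferentiableAt ℝ (w ∘ e.symm) y) :
    MDifferentiableAt (𝓡 d) 𝓘(ℝ, ℝ) w (e.symm y) := by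
  have hx := e.map_target hy
  have h1 : MDifferentiableAt (𝓡 d) (𝓡 d) e (e.symm y) :=
    (mdifferentiable_of_mem_atlas he).mdifferentiableAt hx
  have h2 : MDifferentiableAt (𝓡 d) 𝓘(ℝ, ℝ) (w ∘ e.symm) (e (e.symm y)) := by
    rw [e.right_inv hy]
    exact hw.mdifferentiableAt
  refine (h2.comp _ h1).congr_of_eventuallyEq ?_
  filter_upwards [e.open_source.mem_nhds hx] with z hz
  simp [e.left_inv hz]

theorem mfderiv_apply_eq_fderiv_components (he : e ∈ atlas (EuclideanSpace ℝ (Fin d)) M)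
    {y : EuclideanSpace ℝ (Fin d)} (hy : y ∈ e.target) {w : M → ℝ}
    (hw : MDifferentiableAt (𝓡 d) 𝓘(ℝ, ℝ) w (e.symm y)) (X : ∀ x : M, TangentSpace (𝓡 d) x) :
    mfderiv (𝓡 d) 𝓘(ℝ, ℝ) w (e.symm y) (X (e.symm y)) =
      fderiv ℝ (w ∘ e.symm) y (components e X y) := by
  rw [fderiv_comp_chart_symm he hy hw, mfderiv_chart_symm_components he X hy]

theorem contDiffOn_comp_chart_symm (he : e ∈ atlas (EuclideanSpace ℝ (Fin d)) M) {n : ℕ∞}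
    {w : M → ℝ} (hw : ContMDiff (𝓡 d) 𝓘(ℝ, ℝ) n w) : ContDiffOn ℝ n (w ∘ e.symm) e.target := by
  have hsm : ContMDiffOn (𝓡 d) (𝓡 d) ∞ e.symm e.target :=
    contMDiffOn_symm_of_mem_maximalAtlas (IsManifold.subset_maximalAtlas he)
  exact contMDiffOn_iff_contDiffOn.1
    (hw.comp_contMDiffOn (hsm.of_le (by exact_mod_cast le_top)))

end Smooth

variable [RiemannianBundle (fun x : M ↦ TangentSpace (𝓡 d) x)]

theorem inner_grad (w : M → ℝ) (x : M) (v : TangentSpace (𝓡 d) x) :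
    inner ℝ (grad d w x) v = mfderiv (𝓡 d) 𝓘(ℝ, ℝ) w x v := by
  have : FiniteDimensional ℝ (TangentSpace (𝓡 d) x) :=
    inferInstanceAs (FiniteDimensional ℝ (EuclideanSpace ℝ (Fin d)))
  have : CompleteSpace (TangentSpace (𝓡 d) x) := FiniteDimensional.complete ℝ _
  exact InnerProductSpace.toDual_symm_apply

theorem mfderiv_chart_symm_eq_sum (y v : EuclideanSpace ℝ (Fin d)) :
    (mfderiv (𝓡 d) (𝓡 d) e.symm y v : TangentSpace (𝓡 d) (e.symm y)) =
      ∑ i, v i • coordVector e y i := by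
  have hv : v = ∑ i, v i • EuclideanSpace.single i (1 : ℝ) := by
    ext j
    simp [Finset.sum_apply, Pi.single_apply]
  calc (mfderiv (𝓡 d) (𝓡 d) e.symm y v : TangentSpace (𝓡 d) (e.symm y))
      = mfderiv (𝓡 d) (𝓡 d) e.symm y
        (∑ i, v i • EuclideanSpace.single i (1 : ℝ) : EuclideanSpace ℝ (Fin d)) := by rw [← hv]
    _ = _ := by
        erw [map_sum]
        refine Finset.sum_congr rfl fun i _ ↦ ?_
        erw [map_smul]
        rfl

theorem inner_mfderiv_chart_symm (y v w : EuclideanSpace ℝ (Fin d)) :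
    inner ℝ (mfderiv (𝓡 d) (𝓡 d) e.symm y v : TangentSpace (𝓡 d) (e.symm y))
      (mfderiv (𝓡 d) (𝓡 d) e.symm y w : TangentSpace (𝓡 d) (e.symm y)) =
      ∑ i, ∑ j, v i * w j * metricMatrix e y i j := by
  rw [mfderiv_chart_symm_eq_sum, mfderiv_chart_symm_eq_sum, sum_inner]
  refine Finset.sum_congr rfl fun i _ ↦ ?_
  rw [inner_sum]
  refine Finset.sum_congr rfl fun j _ ↦ ?_
  rw [real_inner_smul_left, real_inner_smul_right, metricMatrix, Matrix.of_apply]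
  ring

variable [IsManifold (𝓡 d) ∞ M]

/-- The quadratic form of the matrix is the squared norm of the image under the differential of the
inverse chart, and that differential is injective. -/
theorem metricMatrix_posDef (he : e ∈ atlas (EuclideanSpace ℝ (Fin d)) M)
    {y : EuclideanSpace ℝ (Fin d)} (hy : y ∈ e.target) : (metricMatrix e y).PosDef := by
  refine Matrix.PosDef.of_dotProduct_mulVec_pos ?_ fun v hv ↦ ?_
  · ext i j
    simp [metricMatrix, Matrix.conjTranspose_apply, real_inner_comm]
  · have h := inner_mfderiv_chart_symm (e := e) y (WithLp.toLp 2 v) (WithLp.toLp 2 v)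
    have h2 : star v ⬝ᵥ (metricMatrix e y).mulVec v =
        inner ℝ (mfderiv (𝓡 d) (𝓡 d) e.symm y (WithLp.toLp 2 v) : TangentSpace (𝓡 d) (e.symm y))
          (mfderiv (𝓡 d) (𝓡 d) e.symm y (WithLp.toLp 2 v)) := by
      rw [h]
      simp only [dotProduct, Matrix.mulVec, Finset.mul_sum, star_trivial]
      exact Finset.sum_congr rfl fun i _ ↦ Finset.sum_congr rfl fun j _ ↦ by ring
    rw [h2]
    refine real_inner_self_pos.2 fun h0 ↦ hv ?_
    have h3 := mfderiv_mfderiv_chart_symm he hy (WithLp.toLp 2 v)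
    rw [h0] at h3
    erw [map_zero] at h3
    exact congrArg (WithLp.ofLp) h3.symm

theorem volDensity_pos (he : e ∈ atlas (EuclideanSpace ℝ (Fin d)) M)
    {y : EuclideanSpace ℝ (Fin d)} (hy : y ∈ e.target) : 0 < volDensity e y :=
  Real.sqrt_pos.2 (metricMatrix_posDef he hy).det_pos

variable [IsContMDiffRiemannianBundle (𝓡 d) ∞ (EuclideanSpace ℝ (Fin d))
      (fun x : M ↦ TangentSpace (𝓡 d) x)]

/-- Coordinate vector fields are images of constant sections under the tangent map of the inverse
chart, hence smooth sections; the inner product of smooth sections is smooth. -/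
theorem contDiffOn_metricMatrix (he : e ∈ atlas (EuclideanSpace ℝ (Fin d)) M) (i j : Fin d) :
    ContDiffOn ℝ ∞ (fun y ↦ metricMatrix e y i j) e.target := by
  have hsm : ContMDiffOn (𝓡 d) (𝓡 d) ∞ e.symm e.target :=
    contMDiffOn_symm_of_mem_maximalAtlas (IsManifold.subset_maximalAtlas he)
  have hT := hsm.contMDiffOn_tangentMapWithin (m := ∞) (by simp) e.open_target.uniqueMDiffOn
  have hsec : ∀ k : Fin d, ContMDiffOn (𝓡 d) (𝓡 d).tangent ∞
      (fun y ↦ (⟨e.symm y, coordVector e y k⟩ : TangentBundle (𝓡 d) M)) e.target := by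
    intro k
    have hc : ContMDiff (𝓡 d) (𝓡 d).tangent ∞ (fun y : EuclideanSpace ℝ (Fin d) ↦
        (⟨y, EuclideanSpace.single k (1 : ℝ)⟩ : TangentBundle (𝓡 d) (EuclideanSpace ℝ (Fin d)))) :=
      contMDiff_vectorSpace_iff_contDiff.2 contDiff_const
    refine (hT.comp hc.contMDiffOn fun y hy ↦ hy).congr fun y hy ↦ ?_
    simp only [Function.comp_apply, tangentMapWithin, coordVector]
    rw [mfderivWithin_of_isOpen e.open_target hy]
  have := (hsec i).inner_bundle (hsec j)
  exact contMDiffOn_iff_contDiffOn.1 this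

theorem contDiffOn_det_metricMatrix (he : e ∈ atlas (EuclideanSpace ℝ (Fin d)) M) :
    ContDiffOn ℝ ∞ (fun y ↦ (metricMatrix e y).det) e.target := by
  simp only [Matrix.det_apply]
  refine ContDiffOn.sum fun σ _ ↦ ContDiffOn.const_smul _ ?_
  exact contDiffOn_prod fun i _ ↦ contDiffOn_metricMatrix he _ _

theorem contDiffOn_volDensity (he : e ∈ atlas (EuclideanSpace ℝ (Fin d)) M) :
    ContDiffOn ℝ ∞ (volDensity e) e.target :=
  (contDiffOn_det_metricMatrix he).sqrt fun _ hy ↦ (metricMatrix_posDef he hy).det_pos.ne'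

theorem contDiffOn_metricMatrix_inv (he : e ∈ atlas (EuclideanSpace ℝ (Fin d)) M) (i j : Fin d) :
    ContDiffOn ℝ ∞ (fun y ↦ (metricMatrix e y)⁻¹ i j) e.target := by
  simp only [Matrix.inv_def, Ring.inverse_eq_inv', Matrix.smul_apply, smul_eq_mul]
  refine ((contDiffOn_det_metricMatrix he).inv fun y hy ↦
    (metricMatrix_posDef he hy).det_pos.ne').mul ?_
  simp only [Matrix.adjugate_apply, Matrix.det_apply]
  refine ContDiffOn.sum fun σ _ ↦ ContDiffOn.const_smul _ ?_
  refine contDiffOn_prod fun k _ ↦ ?_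
  by_cases h : σ k = j
  · simp only [h, Matrix.updateRow_self]
    exact contDiffOn_const
  · simp only [Matrix.updateRow_ne h]
    exact contDiffOn_metricMatrix he _ _

/-- Pairing the gradient with the coordinate fields gives the linear system `g c = dw`, which is
then inverted. -/
theorem components_grad (he : e ∈ atlas (EuclideanSpace ℝ (Fin d)) M) {w : M → ℝ}
    (hw : MDifferentiable (𝓡 d) 𝓘(ℝ, ℝ) w) {y : EuclideanSpace ℝ (Fin d)} (hy : y ∈ e.target)
    (i : Fin d) :
    components e (fun x ↦ grad d w x) y i = ∑ j, (metricMatrix e y)⁻¹ i j *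
      fderiv ℝ (w ∘ e.symm) y (EuclideanSpace.single j (1 : ℝ)) := by
  set c := components e (fun x ↦ grad d w x) y with hc
  have h1 : (metricMatrix e y).mulVec c =
      fun j ↦ fderiv ℝ (w ∘ e.symm) y (EuclideanSpace.single j (1 : ℝ)) := by
    ext j
    rw [fderiv_comp_chart_symm he hy (hw _), ← inner_grad]
    conv_rhs => rw [← mfderiv_chart_symm_components he (fun x ↦ grad d w x) hy]
    erw [inner_mfderiv_chart_symm]
    simp only [← hc, Matrix.mulVec, dotProduct]
    refine Finset.sum_congr rfl fun k _ ↦ ?_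
    rw [Finset.sum_eq_single j]
    · simp [metricMatrix, real_inner_comm, mul_comm]
    · intro l _ hl
      simp [hl]
    · simp
  have h2 := congrArg (fun v ↦ (metricMatrix e y)⁻¹.mulVec v i) h1
  simp only [Matrix.mulVec_mulVec] at h2
  rw [Matrix.nonsing_inv_mul _ (metricMatrix_posDef he hy).det_pos.ne'.isUnit,
    Matrix.one_mulVec] at h2
  exact h2

theorem contDiffOn_components_grad (he : e ∈ atlas (EuclideanSpace ℝ (Fin d)) M) {w : M → ℝ}
    {n : ℕ∞} (hw : ContMDiff (𝓡 d) 𝓘(ℝ, ℝ) (n + 1) w) :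
    ContDiffOn ℝ n (fun y ↦ components e (fun x ↦ grad d w x) y) e.target := by
  rw [contDiffOn_euclidean]
  intro i
  have hd : MDifferentiable (𝓡 d) 𝓘(ℝ, ℝ) w := hw.mdifferentiable (by simp)
  refine ContDiffOn.congr ?_ fun y hy ↦ components_grad he hd hy i
  refine ContDiffOn.sum fun j _ ↦ ContDiffOn.mul
    ((contDiffOn_metricMatrix_inv he i j).of_le (by exact_mod_cast le_top)) ?_
  have h := contDiffOn_comp_chart_symm he (n := n + 1) (by exact_mod_cast hw)
  have h' := h.fderiv_of_isOpen (m := n) e.open_target (by push_cast; exact le_rfl)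
  exact h'.clm_apply contDiffOn_const

end ChartCalculus

end WeightedManifold

/-! ### The Riemannian volume in charts. -/

namespace WeightedManifold

section Volume

variable {d : ℕ} {M : Type*} [TopologicalSpace M] [ChartedSpace (EuclideanSpace ℝ (Fin d)) M]
  {e e' : OpenPartialHomeomorph M (EuclideanSpace ℝ (Fin d))} [IsManifold (𝓡 d) ∞ M]

theorem contDiffOn_transition (he : e ∈ atlas (EuclideanSpace ℝ (Fin d)) M)
    (he' : e' ∈ atlas (EuclideanSpace ℝ (Fin d)) M) :
    ContDiffOn ℝ ∞ (e' ∘ e.symm) (e.target ∩ e.symm ⁻¹' e'.source) := by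
  have h1 : ContMDiffOn (𝓡 d) (𝓡 d) ∞ e.symm e.target :=
    contMDiffOn_symm_of_mem_maximalAtlas (IsManifold.subset_maximalAtlas he)
  have h2 : ContMDiffOn (𝓡 d) (𝓡 d) ∞ e' e'.source :=
    contMDiffOn_of_mem_maximalAtlas (IsManifold.subset_maximalAtlas he')
  exact contMDiffOn_iff_contDiffOn.1 (h2.comp' h1)

theorem isOpen_overlap (e e' : OpenPartialHomeomorph M (EuclideanSpace ℝ (Fin d))) :
    IsOpen (e.target ∩ e.symm ⁻¹' e'.source) :=
  e.symm.isOpen_inter_preimage e'.open_source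

theorem mfderiv_chart_symm_transition (he : e ∈ atlas (EuclideanSpace ℝ (Fin d)) M)
    (he' : e' ∈ atlas (EuclideanSpace ℝ (Fin d)) M)
    {y : EuclideanSpace ℝ (Fin d)} (hy : y ∈ e.target) (hy' : e.symm y ∈ e'.source)
    (v : EuclideanSpace ℝ (Fin d)) :
    (mfderiv (𝓡 d) (𝓡 d) e.symm y v : EuclideanSpace ℝ (Fin d)) =
      mfderiv (𝓡 d) (𝓡 d) e'.symm ((e' ∘ e.symm) y) (fderiv ℝ (e' ∘ e.symm) y v) := by
  have hev : e'.symm ∘ (e' ∘ e.symm) =ᶠ[𝓝 y] e.symm := by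
    filter_upwards [(isOpen_overlap e e').mem_nhds ⟨hy, hy'⟩] with z hz
    exact e'.left_inv hz.2
  have hτ : MDifferentiableAt (𝓡 d) (𝓡 d) (e' ∘ e.symm) y :=
    (((contDiffOn_transition he he').contDiffAt
      ((isOpen_overlap e e').mem_nhds ⟨hy, hy'⟩)).differentiableAt (by simp)).mdifferentiableAt
  have h := mfderiv_comp y (mdifferentiableAt_chart_symm he' (e'.map_source hy')) hτ
  have h2 := hev.mfderiv_eq (I := 𝓡 d) (I' := 𝓡 d)
  rw [h] at h2
  rw [← mfderiv_eq_fderiv]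
  exact congrArg (fun T : EuclideanSpace ℝ (Fin d) →L[ℝ] EuclideanSpace ℝ (Fin d) ↦ T v) h2.symm

variable [RiemannianBundle (fun x : M ↦ TangentSpace (𝓡 d) x)]

theorem metricMatrix_transition (he : e ∈ atlas (EuclideanSpace ℝ (Fin d)) M)
    (he' : e' ∈ atlas (EuclideanSpace ℝ (Fin d)) M)
    {y : EuclideanSpace ℝ (Fin d)} (hy : y ∈ e.target) (hy' : e.symm y ∈ e'.source) (i j : Fin d) :
    metricMatrix e y i j = ∑ k, ∑ l,
      fderiv ℝ (e' ∘ e.symm) y (EuclideanSpace.single i 1) k *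
      fderiv ℝ (e' ∘ e.symm) y (EuclideanSpace.single j 1) l *
      metricMatrix e' ((e' ∘ e.symm) y) k l := by
  rw [← inner_mfderiv_chart_symm, metricMatrix, Matrix.of_apply]
  let g : M → EuclideanSpace ℝ (Fin d) → EuclideanSpace ℝ (Fin d) → ℝ := fun x a b ↦
    inner ℝ (E := TangentSpace (𝓡 d) x) a b
  have hpt : e'.symm ((e' ∘ e.symm) y) = e.symm y := e'.left_inv hy'
  change g (e.symm y) (mfderiv (𝓡 d) (𝓡 d) e.symm y (EuclideanSpace.single i (1 : ℝ)))
    (mfderiv (𝓡 d) (𝓡 d) e.symm y (EuclideanSpace.single j (1 : ℝ))) =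
    g (e'.symm ((e' ∘ e.symm) y))
      (mfderiv (𝓡 d) (𝓡 d) e'.symm ((e' ∘ e.symm) y)
        (fderiv ℝ (e' ∘ e.symm) y (EuclideanSpace.single i (1 : ℝ))))
      (mfderiv (𝓡 d) (𝓡 d) e'.symm ((e' ∘ e.symm) y)
        (fderiv ℝ (e' ∘ e.symm) y (EuclideanSpace.single j (1 : ℝ))))
  rw [hpt]
  congr 1
  · exact mfderiv_chart_symm_transition he he' hy hy' _
  · exact mfderiv_chart_symm_transition he he' hy hy' _

/-- With `J` the Jacobian of the transition map, `G = Jᵀ G' J`, and one takes the square root of the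
determinant. -/
theorem volDensity_transition (he : e ∈ atlas (EuclideanSpace ℝ (Fin d)) M)
    (he' : e' ∈ atlas (EuclideanSpace ℝ (Fin d)) M)
    {y : EuclideanSpace ℝ (Fin d)} (hy : y ∈ e.target) (hy' : e.symm y ∈ e'.source) :
    volDensity e y = |(fderiv ℝ (e' ∘ e.symm) y).det| * volDensity e' ((e' ∘ e.symm) y) := by
  set T := fderiv ℝ (e' ∘ e.symm) y with hT
  let b := (EuclideanSpace.basisFun (Fin d) ℝ).toBasis
  set J := LinearMap.toMatrix b b (T : EuclideanSpace ℝ (Fin d) →ₗ[ℝ] _)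
  have hJ : ∀ k i, J k i = T (EuclideanSpace.single i 1) k := fun k i ↦ by
    simp [J, b, LinearMap.toMatrix_apply]
  have hdet : J.det = T.det := LinearMap.det_toMatrix b _
  have hG : metricMatrix e y = J.transpose * metricMatrix e' ((e' ∘ e.symm) y) * J := by
    ext i j
    rw [metricMatrix_transition he he' hy hy', Matrix.mul_apply]
    simp only [Matrix.mul_apply, Matrix.transpose_apply, Finset.sum_mul, hJ]
    rw [Finset.sum_comm]
    exact Finset.sum_congr rfl fun k _ ↦ Finset.sum_congr rfl fun l _ ↦ by ring
  rw [volDensity, hG, Matrix.det_mul, Matrix.det_mul, Matrix.det_transpose, hdet,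
    show T.det * (metricMatrix e' ((e' ∘ e.symm) y)).det * T.det =
      T.det ^ 2 * (metricMatrix e' ((e' ∘ e.symm) y)).det by ring,
    Real.sqrt_mul (sq_nonneg _), Real.sqrt_sq_eq_abs]
  rfl

variable [MeasurableSpace M] [BorelSpace M]

theorem measurableEmbedding_chart_symm
    (e : OpenPartialHomeomorph M (EuclideanSpace ℝ (Fin d))) :
    MeasurableEmbedding (fun y : e.target ↦ e.symm y) :=
  e.symm.isOpenEmbedding_restrict.measurableEmbedding

theorem aemeasurable_chart_symm (e : OpenPartialHomeomorph M (EuclideanSpace ℝ (Fin d)))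
    (m : Measure (EuclideanSpace ℝ (Fin d))) (hm : m e.targetᶜ = 0) : AEMeasurable e.symm m := by
  have : m.restrict e.target = m := Measure.restrict_eq_self_of_ae_mem (mem_ae_iff.2 hm)
  rw [← this]
  exact e.continuousOn_symm.aemeasurable e.open_target.measurableSet

theorem measurableSet_chart_symm_preimage
    (e : OpenPartialHomeomorph M (EuclideanSpace ℝ (Fin d))) {A : Set M} (hA : MeasurableSet A) :
    MeasurableSet (e.symm ⁻¹' A ∩ e.target) := by
  have := e.open_target.measurableSet.subtype_image
    ((measurableEmbedding_chart_symm e).measurable hA)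
  convert this using 1
  ext y
  simp [and_comm]

theorem chartVolume_apply (e : OpenPartialHomeomorph M (EuclideanSpace ℝ (Fin d)))
    {A : Set M} (hA : MeasurableSet A) :
    chartVolume e A = ∫⁻ y in e.symm ⁻¹' A ∩ e.target, ENNReal.ofReal (volDensity e y) := by
  rw [chartVolume, Measure.map_apply_of_aemeasurable _ hA, withDensity_apply',
    Measure.restrict_restrict' e.open_target.measurableSet]
  refine aemeasurable_chart_symm e _ (withDensity_absolutelyContinuous _ _ ?_)
  rw [Measure.restrict_apply' e.open_target.measurableSet]
  simp

/-- The transition rule for the density cancels the Jacobian in the change of variables formula. -/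
theorem chartVolume_eq_of_subset (he : e ∈ atlas (EuclideanSpace ℝ (Fin d)) M)
    (he' : e' ∈ atlas (EuclideanSpace ℝ (Fin d)) M) {A : Set M} (hA : MeasurableSet A)
    (hAe : A ⊆ e.source) (hAe' : A ⊆ e'.source) : chartVolume e' A = chartVolume e A := by
  rw [chartVolume_apply e' hA, chartVolume_apply e hA]
  have himg : e'.symm ⁻¹' A ∩ e'.target = (e' ∘ e.symm) '' (e.symm ⁻¹' A ∩ e.target) := by
    ext z
    constructor
    · rintro ⟨hz, hz'⟩
      refine ⟨e (e'.symm z), ⟨?_, e.map_source (hAe hz)⟩, ?_⟩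
      · simpa [e.left_inv (hAe hz)] using hz
      · simp [e.left_inv (hAe hz), e'.right_inv hz']
    · rintro ⟨y, ⟨hy, hy'⟩, rfl⟩
      exact ⟨by simpa [e'.left_inv (hAe' hy)] using hy, e'.map_source (hAe' hy)⟩
  rw [himg, lintegral_image_eq_lintegral_abs_det_fderiv_mul volume
    (measurableSet_chart_symm_preimage e hA) (f' := fderiv ℝ (e' ∘ e.symm))]
  · refine setLIntegral_congr_fun (measurableSet_chart_symm_preimage e hA) fun y hy ↦ ?_
    rw [volDensity_transition he he' hy.2 (hAe' hy.1), ENNReal.ofReal_mul (abs_nonneg _)]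
  · intro y hy
    exact (((contDiffOn_transition he he').contDiffAt
      ((isOpen_overlap e e').mem_nhds ⟨hy.2, hAe' hy.1⟩)).differentiableAt
        (by simp)).hasFDerivAt.hasFDerivWithinAt
  · intro y hy z hz h
    exact e.symm.injOn hy.2 hz.2 (e'.injOn (hAe' hy.1) (hAe' hz.1) h)

theorem riemannianVolume_apply_of_subset (he : e ∈ atlas (EuclideanSpace ℝ (Fin d)) M)
    {A : Set M} (hA : MeasurableSet A) (hAe : A ⊆ e.source) :
    riemannianVolume d M A = chartVolume e A := by
  refine le_antisymm ?_ ?_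
  -- A supremum of measures cannot be evaluated set by set, so an explicit upper bound for all chart
  -- measures is used. The infinite multiple of the volume off `e.source` dominates whatever lies
  -- there and vanishes on `A`.
  · have hle : riemannianVolume d M ≤ chartVolume e + (⊤ : ℝ≥0∞) •
        (riemannianVolume d M).restrict e.sourceᶜ := by
      refine iSup₂_le fun e' he' ↦ ?_
      refine Measure.le_iff.2 fun B hB ↦ ?_
      have hs := e.open_source.measurableSet
      have hs' := e'.open_source.measurableSet
      rw [← measure_inter_add_sdiff B hs, Measure.add_apply, Measure.smul_apply,
        Measure.restrict_apply hB]
      have h0 : chartVolume e' (e'.sourceᶜ) = 0 := by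
        rw [chartVolume_apply e' hs'.compl]
        have : e'.symm ⁻¹' e'.sourceᶜ ∩ e'.target = ∅ := by
          ext y
          simp only [Set.mem_inter_iff, Set.mem_preimage, Set.mem_compl_iff, Set.mem_empty_iff_false,
            iff_false, not_and]
          exact fun h hy ↦ h (e'.map_target hy)
        rw [this, Measure.restrict_empty, lintegral_zero_measure]
      refine add_le_add ?_ ?_
      · rw [← measure_inter_add_sdiff (B ∩ e.source) hs']
        rw [measure_mono_null (fun x hx ↦ hx.2 : (B ∩ e.source) \ e'.source ⊆ e'.sourceᶜ) h0,
          add_zero, chartVolume_eq_of_subset he he' ((hB.inter hs).inter hs')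
            (fun x hx ↦ hx.1.2) (fun x hx ↦ hx.2)]
        exact measure_mono fun x hx ↦ hx.1.1
      · rw [← Set.sdiff_eq]
        have : chartVolume e' (B \ e.source) ≤ riemannianVolume d M (B \ e.source) :=
          (le_iSup₂_of_le (f := fun e _ ↦ chartVolume e) e' he' le_rfl : chartVolume e' ≤ _) _
        refine this.trans ?_
        exact le_mul_of_one_le_left (zero_le) le_top
    refine (hle A).trans ?_
    rw [Measure.add_apply, Measure.smul_apply, Measure.restrict_apply hA]
    have : A ∩ e.sourceᶜ = ∅ := by
      rw [← Set.sdiff_eq, Set.sdiff_eq_empty]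
      exact hAe
    simp [this]
  · exact (le_iSup₂_of_le (f := fun e _ ↦ chartVolume e) e he le_rfl : chartVolume e ≤ _) A

theorem riemannianVolume_restrict_source (he : e ∈ atlas (EuclideanSpace ℝ (Fin d)) M) :
    (riemannianVolume d M).restrict e.source = chartVolume e := by
  ext A hA
  have hs := e.open_source.measurableSet
  rw [Measure.restrict_apply hA, riemannianVolume_apply_of_subset he (hA.inter hs) fun x hx ↦ hx.2,
    chartVolume_apply e (hA.inter hs), chartVolume_apply e hA]
  congr 2
  ext y
  simp only [Set.mem_inter_iff, Set.mem_preimage]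
  exact ⟨fun h ↦ ⟨h.1.1, h.2⟩, fun h ↦ ⟨⟨h.1, e.map_target h.2⟩, h.2⟩⟩

variable [IsContMDiffRiemannianBundle (𝓡 d) ∞ (EuclideanSpace ℝ (Fin d))
      (fun x : M ↦ TangentSpace (𝓡 d) x)]

/-- On the subtype `e.target` the inverse chart is a measurable embedding, so integrals can be
transported with no measurability condition on the integrand. -/
theorem chartVolume_eq_map (e : OpenPartialHomeomorph M (EuclideanSpace ℝ (Fin d))) :
    chartVolume e = ((((volume : Measure (EuclideanSpace ℝ (Fin d))).restrict e.target).withDensity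
      fun y ↦ ENNReal.ofReal (volDensity e y)).comap ((↑) : e.target → _)).map
      (fun y : e.target ↦ e.symm y) := by
  set m := ((volume : Measure (EuclideanSpace ℝ (Fin d))).restrict e.target).withDensity
      fun y ↦ ENNReal.ofReal (volDensity e y) with hm
  have hm0 : m e.targetᶜ = 0 := by
    refine withDensity_absolutelyContinuous _ _ ?_
    rw [Measure.restrict_apply' e.open_target.measurableSet]
    simp
  have hmr : (m.comap ((↑) : e.target → _)).map ((↑) : e.target → _) = m := by
    rw [map_comap_subtype_coe e.open_target.measurableSet]
    exact Measure.restrict_eq_self_of_ae_mem (mem_ae_iff.2 hm0)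
  calc chartVolume e = m.map e.symm := rfl
    _ = ((m.comap ((↑) : e.target → _)).map ((↑) : e.target → _)).map e.symm := by rw [hmr]
    _ = _ := by
      rw [AEMeasurable.map_map_of_aemeasurable _ measurable_subtype_coe.aemeasurable]
      · rfl
      · rw [hmr]
        exact aemeasurable_chart_symm e _ hm0

theorem aemeasurable_volDensity (he : e ∈ atlas (EuclideanSpace ℝ (Fin d)) M) :
    AEMeasurable (fun y ↦ ENNReal.ofReal (volDensity e y))
      ((volume : Measure (EuclideanSpace ℝ (Fin d))).restrict e.target) :=
  ((contDiffOn_volDensity he).continuousOn.aemeasurable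
    e.open_target.measurableSet).ennreal_ofReal

theorem integral_eq_integral_chart (he : e ∈ atlas (EuclideanSpace ℝ (Fin d)) M) {F : M → ℝ}
    (hF : ∀ x ∉ e.source, F x = 0) :
    ∫ x, F x ∂(riemannianVolume d M) = ∫ y in e.target, volDensity e y * F (e.symm y) := by
  have ht := e.open_target.measurableSet
  rw [← setIntegral_eq_integral_of_forall_compl_eq_zero hF, riemannianVolume_restrict_source he,
    chartVolume_eq_map, (measurableEmbedding_chart_symm e).integral_map]
  rw [← (MeasurableEmbedding.subtype_coe ht).integral_map (fun y ↦ F (e.symm y)),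
    map_comap_subtype_coe ht, restrict_withDensity ht,
    Measure.restrict_restrict ht, Set.inter_self,
    integral_withDensity_eq_integral_toReal_smul₀ (aemeasurable_volDensity he) (by simp)]
  refine setIntegral_congr_fun ht fun y hy ↦ ?_
  simp [ENNReal.toReal_ofReal (volDensity_pos he hy).le]

theorem integrable_iff_integrableOn_chart (he : e ∈ atlas (EuclideanSpace ℝ (Fin d)) M) {F : M → ℝ}
    (hF : ∀ x ∉ e.source, F x = 0) :
    Integrable F (riemannianVolume d M) ↔
      IntegrableOn (fun y ↦ volDensity e y * F (e.symm y)) e.target := by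
  have ht := e.open_target.measurableSet
  have h1 : Integrable F (riemannianVolume d M) ↔ IntegrableOn F e.source (riemannianVolume d M) :=
    (integrableOn_iff_integrable_of_support_subset fun x hx ↦ by_contra fun h ↦ hx (hF x h)).symm
  rw [h1, IntegrableOn, riemannianVolume_restrict_source he,
    chartVolume_eq_map, (measurableEmbedding_chart_symm e).integrable_map_iff]
  have h2 := (MeasurableEmbedding.subtype_coe ht).integrable_map_iff (g := fun y ↦ F (e.symm y))
    (μ := (((volume : Measure (EuclideanSpace ℝ (Fin d))).restrict e.target).withDensity
      fun y ↦ ENNReal.ofReal (volDensity e y)).comap ((↑) : e.target → _))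
  rw [map_comap_subtype_coe ht, restrict_withDensity ht,
    Measure.restrict_restrict ht, Set.inter_self,
    integrable_withDensity_iff_integrable_smul₀' (aemeasurable_volDensity he) (by simp)] at h2
  refine h2.symm.trans ?_
  refine integrable_congr ?_
  filter_upwards [ae_restrict_mem ht] with y hy
  simp [ENNReal.toReal_ofReal (volDensity_pos he hy).le]

theorem riemannianVolume_isLocallyFinite : IsLocallyFiniteMeasure (riemannianVolume d M) := by
  refine ⟨fun x ↦ ?_⟩
  set e := chartAt (EuclideanSpace ℝ (Fin d)) x
  have he : e ∈ atlas (EuclideanSpace ℝ (Fin d)) M := chart_mem_atlas _ x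
  have hx : x ∈ e.source := mem_chart_source _ x
  obtain ⟨K, hK, hxK, hKe⟩ := exists_compact_subset e.open_target (e.map_source hx)
  refine ⟨e.source ∩ e ⁻¹' (interior K), ?_, ?_⟩
  · exact (e.isOpen_inter_preimage isOpen_interior).mem_nhds ⟨hx, hxK⟩
  · rw [riemannianVolume_apply_of_subset he
      (e.isOpen_inter_preimage isOpen_interior).measurableSet fun z hz ↦ hz.1,
      chartVolume_apply e (e.isOpen_inter_preimage isOpen_interior).measurableSet]
    have hsub : e.symm ⁻¹' (e.source ∩ e ⁻¹' (interior K)) ∩ e.target ⊆ K := fun y hy ↦ by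
      have := hy.1.2
      rw [Set.mem_preimage, e.right_inv hy.2] at this
      exact interior_subset this
    refine (lintegral_mono_set hsub).trans_lt ?_
    have hcont := (contDiffOn_volDensity he).continuousOn.mono hKe
    have := (hcont.integrableOn_compact (μ := volume) hK).2
    refine lt_of_le_of_lt (lintegral_mono fun y ↦ ?_) this
    rw [← ofReal_norm, Real.norm_eq_abs]
    exact ENNReal.ofReal_le_ofReal (le_abs_self _)

theorem riemannianVolume_isOpenPos : (riemannianVolume d M).IsOpenPosMeasure := by
  refine ⟨fun U hU ⟨x, hx⟩ h0 ↦ ?_⟩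
  set e := chartAt (EuclideanSpace ℝ (Fin d)) x
  have he : e ∈ atlas (EuclideanSpace ℝ (Fin d)) M := chart_mem_atlas _ x
  have hxe : x ∈ e.source := mem_chart_source _ x
  have hm : MeasurableSet (U ∩ e.source) := (hU.inter e.open_source).measurableSet
  have h1 := measure_mono_null (Set.inter_subset_left : U ∩ e.source ⊆ U) h0
  rw [riemannianVolume_apply_of_subset he hm Set.inter_subset_right, chartVolume_apply e hm] at h1
  set S := e.symm ⁻¹' (U ∩ e.source) ∩ e.target
  have hS : IsOpen S := by
    rw [show S = e.target ∩ e.symm ⁻¹' (U ∩ e.source) from Set.inter_comm _ _]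
    exact e.symm.isOpen_inter_preimage (hU.inter e.open_source)
  have hSt : S ⊆ e.target := Set.inter_subset_right
  have hae : AEMeasurable (fun y ↦ ENNReal.ofReal (volDensity e y)) (volume.restrict S) :=
    (aemeasurable_volDensity he).mono_measure (Measure.restrict_mono hSt le_rfl)
  rw [lintegral_eq_zero_iff' hae] at h1
  have h2 : ∀ᵐ y ∂((volume : Measure (EuclideanSpace ℝ (Fin d))).restrict S), False := by
    filter_upwards [h1, ae_restrict_mem hS.measurableSet] with y hy hyS
    simp only [Pi.zero_apply, ENNReal.ofReal_eq_zero] at hy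
    exact absurd (volDensity_pos he (hSt hyS)) hy.not_gt
  have h3 : (volume : Measure (EuclideanSpace ℝ (Fin d))) S = 0 := by
    simpa using h2
  refine (hS.measure_pos volume ⟨e x, ?_, e.map_source hxe⟩).ne' h3
  simp [e.left_inv hxe, hx, hxe]

end Volume

end WeightedManifold

/-! ### Lipschitz functions and integration by parts in Euclidean space. -/

section LocallyLipschitz

theorem LipschitzOnWith.exists_mul_nhds {α : Type*} [PseudoMetricSpace α] {f g : α → ℝ} {y : α}
    (hf : ∃ K, ∃ U ∈ 𝓝 y, LipschitzOnWith K f U) (hg : ∃ K, ∃ U ∈ 𝓝 y, LipschitzOnWith K g U) :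
    ∃ K, ∃ U ∈ 𝓝 y, LipschitzOnWith K (fun z ↦ f z * g z) U := by
  obtain ⟨K, U, hU, hf⟩ := hf
  obtain ⟨L, V, hV, hg⟩ := hg
  have hfc : ContinuousAt f y := (hf.continuousOn).continuousAt hU
  have hgc : ContinuousAt g y := (hg.continuousOn).continuousAt hV
  have hfb : ∀ᶠ z in 𝓝 y, ‖f z‖ < ‖f y‖ + 1 := hfc.norm.eventually_lt_const (by linarith)
  have hgb : ∀ᶠ z in 𝓝 y, ‖g z‖ < ‖g y‖ + 1 := hgc.norm.eventually_lt_const (by linarith)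
  refine ⟨(‖f y‖₊ + 1) * L + (‖g y‖₊ + 1) * K, _, inter_mem (inter_mem hU hV) (hfb.and hgb),
    LipschitzOnWith.of_dist_le_mul fun a ha b hb ↦ ?_⟩
  have h1 := hf.dist_le_mul a ha.1.1 b hb.1.1
  have h2 := hg.dist_le_mul a ha.1.2 b hb.1.2
  have h3 : ‖f a‖ < ‖f y‖ + 1 := ha.2.1
  have h4 : ‖g b‖ < ‖g y‖ + 1 := hb.2.2
  rw [Real.dist_eq] at h1 h2 ⊢
  rw [Real.norm_eq_abs] at h3 h4
  have h5 : f a * g a - f b * g b = f a * (g a - g b) + g b * (f a - f b) := by ring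
  calc |f a * g a - f b * g b| ≤ |f a| * |g a - g b| + |g b| * |f a - f b| := by
        rw [h5, ← abs_mul, ← abs_mul]
        exact abs_add_le _ _
    _ ≤ (‖f y‖ + 1) * (L * dist a b) + (‖g y‖ + 1) * (K * dist a b) := by gcongr
    _ = _ := by
        push_cast
        ring

variable {E : Type*} [NormedAddCommGroup E]

/-- If the support lies in the ball of radius `R`, compactness gives a constant on the ball of
radius `R + 1`. When one point is outside that larger ball, either both values vanish or the points
are at distance at least `1` and the bound `A` on `|g|` suffices. -/
theorem LocallyLipschitz.exists_lipschitzWith [ProperSpace E] {g : E → ℝ}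
    (hg : LocallyLipschitz g) (hc : HasCompactSupport g) : ∃ K, LipschitzWith K g := by
  obtain ⟨R, hR⟩ := hc.isBounded.subset_closedBall 0
  obtain ⟨K, hK⟩ := (hg.locallyLipschitzOn (s := Metric.closedBall 0 (R + 1))
    ).exists_lipschitzOnWith_of_compact (isCompact_closedBall 0 (R + 1))
  obtain ⟨A, hA⟩ := hc.exists_bound_of_continuous hg.continuous
  have hA0 : 0 ≤ A := (norm_nonneg _).trans (hA 0)
  have hzero : ∀ x, x ∉ Metric.closedBall (0 : E) R → g x = 0 := fun x hx ↦
    image_eq_zero_of_notMem_tsupport fun h ↦ hx (hR h)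
  have aux : ∀ x y, y ∉ Metric.closedBall (0 : E) (R + 1) →
      dist (g x) (g y) ≤ (K + A) * dist x y := by
    intro x y hy
    have hy0 := hzero y fun h ↦ hy (Metric.closedBall_subset_closedBall (by linarith) h)
    by_cases hx : x ∈ Metric.closedBall (0 : E) R
    · have h1 : 1 ≤ dist x y := by
        rw [Metric.mem_closedBall, not_le] at hy
        rw [Metric.mem_closedBall] at hx
        linarith [dist_triangle y x 0, dist_comm x y]
      rw [hy0, dist_zero_right]
      calc ‖g x‖ ≤ A := hA x
        _ ≤ (K + A) * 1 := by linarith [K.coe_nonneg]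
        _ ≤ _ := by gcongr
    · rw [hy0, hzero x hx, dist_self]
      positivity
  refine ⟨K + A.toNNReal, LipschitzWith.of_dist_le_mul fun x y ↦ ?_⟩
  rw [NNReal.coe_add, Real.coe_toNNReal A hA0]
  by_cases hx : x ∈ Metric.closedBall (0 : E) (R + 1)
  · by_cases hy : y ∈ Metric.closedBall (0 : E) (R + 1)
    · refine (hK.dist_le_mul x hx y hy).trans ?_
      gcongr
      linarith
    · exact aux x y hy
  · rw [dist_comm, dist_comm x]
    exact aux y x hx

theorem HasCompactSupport.lineDeriv_eq_zero [NormedSpace ℝ E] {g : E → ℝ} {x : E}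
    (hx : x ∉ tsupport g) (v : E) : lineDeriv ℝ g x v = 0 := by
  have h : g =ᶠ[𝓝 x] fun _ ↦ 0 := notMem_tsupport_iff_eventuallyEq.1 hx
  rw [h.lineDeriv_eq]
  simp [lineDeriv]

variable [NormedSpace ℝ E] [MeasurableSpace E] [BorelSpace E] [FiniteDimensional ℝ E]
  {μ : Measure E} [μ.IsAddHaarMeasure]

theorem LipschitzWith.integrable_lineDeriv {g : E → ℝ} {K : NNReal} (hg : LipschitzWith K g)
    (hc : HasCompactSupport g) (v : E) : Integrable (fun x ↦ lineDeriv ℝ g x v) μ := by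
  have h := (hg.locallyIntegrable_lineDeriv (μ := μ) v).integrableOn_isCompact hc
  refine (integrableOn_iff_integrable_of_support_subset fun x hx ↦ ?_).1 h
  by_contra h
  exact hx (HasCompactSupport.lineDeriv_eq_zero h v)

/-- Integration by parts against the constant function `1`. -/
theorem LipschitzWith.integral_lineDeriv_eq_zero {g : E → ℝ} {K : NNReal} (hg : LipschitzWith K g)
    (hc : HasCompactSupport g) (v : E) : ∫ x, lineDeriv ℝ g x v ∂μ = 0 := by
  have h := (LipschitzWith.const (1 : ℝ) : LipschitzWith 0 fun _ : E ↦ (1 : ℝ)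
    ).integral_lineDeriv_mul_eq (μ := μ) hg hc (-v)
  simpa [lineDeriv] using h.symm

end LocallyLipschitz

/-! ### The divergence theorem in a single chart. -/

namespace WeightedManifold

/-- The derivative of the function `w` along the vector field `X`, equal to zero at the points
where `w` is not differentiable. -/
noncomputable def derivAlong {d : ℕ} {M : Type*} [TopologicalSpace M]
    [ChartedSpace (EuclideanSpace ℝ (Fin d)) M] (w : M → ℝ) (X : ∀ x : M, TangentSpace (𝓡 d) x)
    (x : M) : ℝ :=
  mfderiv (𝓡 d) 𝓘(ℝ, ℝ) w x (X x)

variable {d : ℕ} {M : Type*} [MetricSpace M] [ChartedSpace (EuclideanSpace ℝ (Fin d)) M]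
  [IsManifold (𝓡 d) ∞ M] [RiemannianBundle (fun x : M ↦ TangentSpace (𝓡 d) x)]
  [IsContMDiffRiemannianBundle (𝓡 d) ∞ (EuclideanSpace ℝ (Fin d))
      (fun x : M ↦ TangentSpace (𝓡 d) x)]
  [IsRiemannianManifold (𝓡 d) M]
  {e e' : OpenPartialHomeomorph M (EuclideanSpace ℝ (Fin d))}

theorem norm_mfderiv_chart_symm_le (y v : EuclideanSpace ℝ (Fin d)) :
    ‖(mfderiv (𝓡 d) (𝓡 d) e.symm y v : TangentSpace (𝓡 d) (e.symm y))‖ ≤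
      √(∑ i, ∑ j, |metricMatrix e y i j|) * ‖v‖ := by
  refine le_of_sq_le_sq ?_ (by positivity)
  rw [mul_pow, Real.sq_sqrt (by positivity), ← real_inner_self_eq_norm_sq,
    inner_mfderiv_chart_symm, Finset.sum_mul]
  refine Finset.sum_le_sum fun i _ ↦ ?_
  rw [Finset.sum_mul]
  refine Finset.sum_le_sum fun j _ ↦ (le_abs_self _).trans ?_
  rw [abs_mul, abs_mul, mul_comm, sq]
  have h : ∀ k, |v k| ≤ ‖v‖ := fun k ↦ by
    rw [← Real.norm_eq_abs]
    exact PiLp.norm_apply_le v k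
  have := h i
  have := h j
  gcongr

theorem exists_lipschitzOnWith_chart_symm (he : e ∈ atlas (EuclideanSpace ℝ (Fin d)) M)
    {y : EuclideanSpace ℝ (Fin d)} (hy : y ∈ e.target) :
    ∃ K, ∃ U ∈ 𝓝 y, LipschitzOnWith K e.symm U := by
  set S : EuclideanSpace ℝ (Fin d) → ℝ := fun z ↦ ∑ i, ∑ j, |metricMatrix e z i j|
  have hS : ContinuousAt S y := by
    refine ContinuousOn.continuousAt (s := e.target) ?_ (e.open_target.mem_nhds hy)
    exact continuousOn_finsetSum _ fun i _ ↦ continuousOn_finsetSum _ fun j _ ↦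
      (contDiffOn_metricMatrix he i j).continuousOn.abs
  have hev : ∀ᶠ z in 𝓝 y, z ∈ e.target ∧ S z < S y + 1 :=
    (e.open_target.eventually_mem hy).and (hS.eventually_lt_const (by linarith))
  obtain ⟨r, hr, hball⟩ := Metric.eventually_nhds_iff_ball.1 hev
  have hS0 : 0 ≤ S y := by positivity
  refine ⟨⟨√(S y + 1), by positivity⟩, Metric.ball y r, Metric.ball_mem_nhds _ hr,
    LipschitzOnWith.of_dist_le_mul fun a ha b hb ↦ ?_⟩
  have hseg : ∀ t ∈ Set.Icc (0 : ℝ) 1, a + t • (b - a) ∈ Metric.ball y r := fun t ht ↦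
    (convex_ball y r).add_smul_sub_mem ha hb ht
  have h := dist_symm_le_of_segment he (C := √(S y + 1) * ‖b - a‖)
    (fun t ht ↦ (hball _ (hseg t ht)).1) fun t ht ↦ by
      refine (norm_mfderiv_chart_symm_le _ _).trans ?_
      gcongr
      exact (hball _ (hseg t ht)).2.le
  rw [dist_comm a b, dist_eq_norm b a]
  rwa [add_sub_cancel] at h

theorem exists_lipschitzOnWith_comp_chart_symm (he : e ∈ atlas (EuclideanSpace ℝ (Fin d)) M)
    {χ : M → ℝ} {K : NNReal} (hχ : LipschitzWith K χ)
    {y : EuclideanSpace ℝ (Fin d)} (hy : y ∈ e.target) :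
    ∃ K, ∃ U ∈ 𝓝 y, LipschitzOnWith K (fun z ↦ χ (e.symm z)) U := by
  obtain ⟨L, U, hU, hL⟩ := exists_lipschitzOnWith_chart_symm he hy
  exact ⟨K * L, U, hU, hχ.comp_lipschitzOnWith hL⟩

/-- Rademacher's theorem applies on small neighbourhoods where the coordinate expression is
Lipschitz; a locally null set is null. -/
theorem ae_differentiableAt_comp_chart_symm (he : e ∈ atlas (EuclideanSpace ℝ (Fin d)) M)
    {χ : M → ℝ} {K : NNReal} (hχ : LipschitzWith K χ) :
    ∀ᵐ y ∂(volume.restrict e.target), DifferentiableAt ℝ (χ ∘ e.symm) y := by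
  rw [ae_restrict_iff' e.open_target.measurableSet, ae_iff]
  refine measure_null_of_locally_null _ fun y hy ↦ ?_
  simp only [Classical.not_imp, Set.mem_ofPred_eq] at hy
  obtain ⟨L, U, hU, hL⟩ := exists_lipschitzOnWith_comp_chart_symm he hχ hy.1
  refine ⟨_, inter_mem_nhdsWithin _ (interior_mem_nhds.2 hU), ?_⟩
  have h := (hL.mono interior_subset).ae_differentiableWithinAt_of_mem (μ := volume)
  refine measure_mono_null (fun z hz ↦ ?_) (ae_iff.1 h)
  have hz3 := hz.1
  simp only [Classical.not_imp, Set.mem_ofPred_eq] at hz3 ⊢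
  exact ⟨hz.2, fun hz2 ↦ hz3.2 (hz2.differentiableAt (isOpen_interior.mem_nhds hz.2))⟩

/-- The integrand `h dχ(X) + χ dh(X) + χ h div X` of the divergence theorem for the vector field
`χ h X`, with the divergence computed in the chart `e`. -/
noncomputable def divIntegrand (e : OpenPartialHomeomorph M (EuclideanSpace ℝ (Fin d)))
    (X : ∀ x : M, TangentSpace (𝓡 d) x) (χ h : M → ℝ) (x : M) : ℝ :=
  h x * derivAlong χ X x + χ x * derivAlong h X x + χ x * h x * divergenceInChart e X x

variable [MeasurableSpace M] [BorelSpace M]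

/-- Times the density, the integrand equals `∑ ∂ᵢ(χ h √g Xⁱ)` almost everywhere in coordinates, and
each summand is a directional derivative of a compactly supported Lipschitz function. -/
theorem integral_divIntegrand_eq_zero (he : e ∈ atlas (EuclideanSpace ℝ (Fin d)) M)
    {X : ∀ x : M, TangentSpace (𝓡 d) x} (hX : ContDiffOn ℝ 1 (components e X) e.target)
    {χ : M → ℝ} {K : NNReal} (hχ : LipschitzWith K χ) {h : M → ℝ}
    (hh : ContMDiff (𝓡 d) 𝓘(ℝ, ℝ) 1 h) {S : Set M} (hS : IsCompact S) (hSe : S ⊆ e.source)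
    (hS0 : ∀ x ∉ S, h x = 0) :
    Integrable (divIntegrand e X χ h) (riemannianVolume d M) ∧
      ∫ x, divIntegrand e X χ h x ∂(riemannianVolume d M) = 0 := by
  have ht := e.open_target.measurableSet
  -- the components of the density `√g h X`, as functions on the chart
  set V : Fin d → EuclideanSpace ℝ (Fin d) → ℝ := fun i y ↦ volDensity e y * components e X y i
  set H : Fin d → EuclideanSpace ℝ (Fin d) → ℝ := fun i y ↦ h (e.symm y) * V i y
  have hV : ∀ i, ContDiffOn ℝ 1 (V i) e.target := fun i ↦
    ((contDiffOn_volDensity he).of_le (by simp)).mul ((contDiffOn_euclidean.1 hX) i)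
  have hhe : ContDiffOn ℝ 1 (fun y ↦ h (e.symm y)) e.target :=
    contDiffOn_comp_chart_symm he (n := 1) (by exact_mod_cast hh)
  have hH : ∀ i, ContDiffOn ℝ 1 (H i) e.target := fun i ↦ hhe.mul (hV i)
  -- Extension by zero to the whole space. It stays locally Lipschitz because the function already
  -- vanishes on the target off the compact set `e '' S`.
  set g : Fin d → EuclideanSpace ℝ (Fin d) → ℝ := fun i ↦
    e.target.indicator fun y ↦ χ (e.symm y) * H i y
  have hS' : IsCompact (e '' S) := hS.image_of_continuousOn (e.continuousOn.mono hSe)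
  have hS't : e '' S ⊆ e.target := by
    rintro _ ⟨x, hx, rfl⟩
    exact e.map_source (hSe hx)
  have hg0 : ∀ i, ∀ y ∉ e '' S, g i y = 0 := by
    intro i y hy
    by_cases hyt : y ∈ e.target
    · have : e.symm y ∉ S := fun hs ↦ hy ⟨_, hs, e.right_inv hyt⟩
      simp [g, H, hS0 _ this]
    · simp [g, hyt]
  have hgsupp : ∀ i, tsupport (g i) ⊆ e '' S := fun i ↦
    closure_minimal (fun y hy ↦ by_contra fun h ↦ hy (hg0 i y h)) hS'.isClosed
  have hgc : ∀ i, HasCompactSupport (g i) := fun i ↦ hS'.of_isClosed_subset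
    (isClosed_tsupport _) (hgsupp i)
  have hgloc : ∀ i, ∀ y ∈ e.target, g i =ᶠ[𝓝 y] fun y ↦ χ (e.symm y) * H i y := by
    intro i y hy
    filter_upwards [e.open_target.mem_nhds hy] with z hz
    simp [g, hz]
  have hglip : ∀ i, LocallyLipschitz (g i) := by
    intro i y
    by_cases hy : y ∈ e.target
    · obtain ⟨L, U, hU, hL⟩ := LipschitzOnWith.exists_mul_nhds
        (exists_lipschitzOnWith_comp_chart_symm he hχ hy)
        (((hH i).contDiffAt (e.open_target.mem_nhds hy)).exists_lipschitzOnWith)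
      refine ⟨L, U ∩ e.target, inter_mem hU (e.open_target.mem_nhds hy), ?_⟩
      refine LipschitzOnWith.of_dist_le_mul fun a ha b hb ↦ ?_
      simpa [g, ha.2, hb.2] using hL.dist_le_mul a ha.1 b hb.1
    · refine ⟨0, _, hS'.isClosed.isOpen_compl.mem_nhds fun h ↦ hy (hS't h), ?_⟩
      exact LipschitzOnWith.of_dist_le_mul fun a ha b hb ↦ by simp [hg0 i a ha, hg0 i b hb]
  choose L hL using fun i ↦ (hglip i).exists_lipschitzWith (hgc i)
  have hF : ∀ x ∉ e.source, divIntegrand e X χ h x = 0 := by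
    intro x hx
    have hxS : x ∉ S := fun hs ↦ hx (hSe hs)
    have h1 : h =ᶠ[𝓝 x] fun _ ↦ 0 := by
      filter_upwards [hS.isClosed.isOpen_compl.mem_nhds hxS] with z hz using hS0 z hz
    have h2 : derivAlong h X x = 0 := by
      rw [derivAlong, h1.mfderiv_eq, mfderiv_const]
      rfl
    simp [divIntegrand, hS0 x hxS, h2]
  set D : EuclideanSpace ℝ (Fin d) → ℝ := fun y ↦
    ∑ i, lineDeriv ℝ (g i) y (EuclideanSpace.single i 1)
  have hD : Integrable D := integrable_finsetSum _ fun i _ ↦ (hL i).integrable_lineDeriv (hgc i) _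
  have hDint : ∫ y, D y = 0 := by
    rw [integral_finsetSum _ fun i _ ↦ (hL i).integrable_lineDeriv (hgc i) _]
    exact Finset.sum_eq_zero fun i _ ↦ (hL i).integral_lineDeriv_eq_zero (hgc i) _
  have hDt : ∀ y ∉ e.target, D y = 0 := fun y hy ↦ Finset.sum_eq_zero fun i _ ↦
    HasCompactSupport.lineDeriv_eq_zero (fun h ↦ hy (hS't (hgsupp i h))) _
  have hae : (fun y ↦ volDensity e y * divIntegrand e X χ h (e.symm y))
      =ᵐ[volume.restrict e.target] D := by
    filter_upwards [ae_differentiableAt_comp_chart_symm he hχ, ae_restrict_mem ht] with y hχy hy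
    have hnhds := e.open_target.mem_nhds hy
    have hhd : DifferentiableAt ℝ (h ∘ e.symm) y :=
      (hhe.contDiffAt hnhds).differentiableAt one_ne_zero
    have hVd : ∀ i, DifferentiableAt ℝ (V i) y := fun i ↦
      ((hV i).contDiffAt hnhds).differentiableAt one_ne_zero
    have hsum : ∀ T : EuclideanSpace ℝ (Fin d) →L[ℝ] ℝ, volDensity e y * T (components e X y) =
        ∑ i, V i y * T (EuclideanSpace.single i 1) := by
      intro T
      have hv : components e X y =
          ∑ i, components e X y i • EuclideanSpace.single i (1 : ℝ) := by
        ext j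
        simp [Finset.sum_apply, Pi.single_apply]
      conv_lhs => rw [hv, map_sum, Finset.mul_sum]
      refine Finset.sum_congr rfl fun i _ ↦ ?_
      rw [map_smul, smul_eq_mul, mul_assoc]
    have hline : ∀ i, lineDeriv ℝ (g i) y (EuclideanSpace.single i 1) =
        h (e.symm y) * (V i y * fderiv ℝ (χ ∘ e.symm) y (EuclideanSpace.single i 1)) +
        χ (e.symm y) * (V i y * fderiv ℝ (h ∘ e.symm) y (EuclideanSpace.single i 1)) +
        χ (e.symm y) * h (e.symm y) * fderiv ℝ (V i) y (EuclideanSpace.single i 1) := by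
      intro i
      rw [(hgloc i y hy).lineDeriv_eq]
      have hd := hχy.hasFDerivAt.mul (hhd.hasFDerivAt.mul (hVd i).hasFDerivAt)
      have hd' : HasFDerivAt (fun y ↦ χ (e.symm y) * H i y) _ y := hd
      rw [(hd'.hasLineDerivAt _).lineDeriv]
      simp only [add_apply, smul_apply, smul_eq_mul,
        Function.comp_apply, Pi.mul_apply]
      ring
    have hdχ : derivAlong χ X (e.symm y) = fderiv ℝ (χ ∘ e.symm) y (components e X y) :=
      mfderiv_apply_eq_fderiv_components he hy (mdifferentiableAt_of_comp_chart_symm he hy hχy) X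
    have hdh : derivAlong h X (e.symm y) = fderiv ℝ (h ∘ e.symm) y (components e X y) :=
      mfderiv_apply_eq_fderiv_components he hy (mdifferentiableAt_of_comp_chart_symm he hy hhd) X
    have hdiv : volDensity e y * divergenceInChart e X (e.symm y) =
        ∑ i, fderiv ℝ (V i) y (EuclideanSpace.single i 1) := by
      rw [divergenceInChart, e.right_inv hy, ← mul_assoc,
        mul_inv_cancel₀ (volDensity_pos he hy).ne', one_mul]
    have hexp : volDensity e y * divIntegrand e X χ h (e.symm y) =
        h (e.symm y) * (volDensity e y * derivAlong χ X (e.symm y)) +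
        χ (e.symm y) * (volDensity e y * derivAlong h X (e.symm y)) +
        χ (e.symm y) * h (e.symm y) * (volDensity e y * divergenceInChart e X (e.symm y)) := by
      rw [divIntegrand]
      ring
    rw [hexp, hdχ, hdh, hdiv, hsum, hsum]
    simp only [D, hline, Finset.sum_add_distrib, Finset.mul_sum]
  refine ⟨(integrable_iff_integrableOn_chart he hF).2 (hD.integrableOn.congr hae.symm), ?_⟩
  rw [integral_eq_integral_chart he hF, integral_congr_ae hae,
    setIntegral_eq_integral_of_forall_compl_eq_zero hDt, hDint]

end WeightedManifold

/-! ### Chart independence of the divergence and the global divergence theorem. -/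

namespace WeightedManifold

section DerivAlong

variable {d : ℕ} {M : Type*} [TopologicalSpace M] [ChartedSpace (EuclideanSpace ℝ (Fin d)) M]
  {X : ∀ x : M, TangentSpace (𝓡 d) x} {v w : M → ℝ} {x : M}

theorem derivAlong_congr (h : v =ᶠ[𝓝 x] w) : derivAlong v X x = derivAlong w X x := by
  rw [derivAlong, h.mfderiv_eq]
  rfl

theorem derivAlong_const (c : ℝ) : derivAlong (fun _ ↦ c) X x = 0 := by
  rw [derivAlong, mfderiv_const]
  rfl

theorem derivAlong_add (hv : MDifferentiableAt (𝓡 d) 𝓘(ℝ, ℝ) v x)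
    (hw : MDifferentiableAt (𝓡 d) 𝓘(ℝ, ℝ) w x) :
    derivAlong (fun z ↦ v z + w z) X x = derivAlong v X x + derivAlong w X x := by
  have h : HasMFDerivAt (𝓡 d) 𝓘(ℝ, ℝ) (fun z ↦ v z + w z) x _ :=
    hv.hasMFDerivAt.add hw.hasMFDerivAt
  rw [derivAlong, h.mfderiv]
  rfl

theorem derivAlong_mul (hv : MDifferentiableAt (𝓡 d) 𝓘(ℝ, ℝ) v x)
    (hw : MDifferentiableAt (𝓡 d) 𝓘(ℝ, ℝ) w x) :
    derivAlong (fun z ↦ v z * w z) X x = v x * derivAlong w X x + w x * derivAlong v X x := by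
  have h : HasMFDerivAt (𝓡 d) 𝓘(ℝ, ℝ) (fun z ↦ v z * w z) x _ :=
    hv.hasMFDerivAt.mul hw.hasMFDerivAt
  rw [derivAlong, h.mfderiv]
  rfl

theorem derivAlong_comp {G : ℝ → ℝ} {G' : ℝ} (hG : HasDerivAt G G' (w x))
    (hw : MDifferentiableAt (𝓡 d) 𝓘(ℝ, ℝ) w x) :
    derivAlong (fun z ↦ G (w z)) X x = G' * derivAlong w X x := by
  have h : HasMFDerivAt (𝓡 d) 𝓘(ℝ, ℝ) (fun z ↦ G (w z)) x _ :=
    hG.hasFDerivAt.hasMFDerivAt.comp x hw.hasMFDerivAt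
  rw [derivAlong, h.mfderiv, mul_comm]
  rfl

theorem derivAlong_sum {ι : Type*} (s : Finset ι) {w : ι → M → ℝ}
    (hw : ∀ i ∈ s, ContMDiff (𝓡 d) 𝓘(ℝ, ℝ) 1 (w i)) :
    derivAlong (fun z ↦ ∑ i ∈ s, w i z) X x = ∑ i ∈ s, derivAlong (w i) X x := by
  classical
  induction s using Finset.induction_on with
  | empty => simpa using derivAlong_const 0
  | insert a s ha ih =>
    simp only [Finset.sum_insert ha]
    have h1 : ContMDiff (𝓡 d) 𝓘(ℝ, ℝ) 1 fun z ↦ ∑ i ∈ s, w i z :=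
      contMDiff_finsetSum fun i hi ↦ hw i (Finset.mem_insert_of_mem hi)
    rw [derivAlong_add ((hw a (Finset.mem_insert_self _ _)).mdifferentiable one_ne_zero _)
      (h1.mdifferentiable one_ne_zero _), ih fun i hi ↦ hw i (Finset.mem_insert_of_mem hi)]

end DerivAlong

variable {d : ℕ} {M : Type*} [MetricSpace M] [ChartedSpace (EuclideanSpace ℝ (Fin d)) M]
  [IsManifold (𝓡 d) ∞ M] [RiemannianBundle (fun x : M ↦ TangentSpace (𝓡 d) x)]
  [IsContMDiffRiemannianBundle (𝓡 d) ∞ (EuclideanSpace ℝ (Fin d))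
      (fun x : M ↦ TangentSpace (𝓡 d) x)]
  [IsRiemannianManifold (𝓡 d) M]
  {e e' : OpenPartialHomeomorph M (EuclideanSpace ℝ (Fin d))}
  {X : ∀ x : M, TangentSpace (𝓡 d) x}

theorem continuousOn_divergenceInChart (he : e ∈ atlas (EuclideanSpace ℝ (Fin d)) M)
    (hX : ContDiffOn ℝ 1 (components e X) e.target) :
    ContinuousOn (divergenceInChart e X) e.source := by
  have hmaps : Set.MapsTo e e.source e.target := e.mapsTo
  refine ContinuousOn.mul (ContinuousOn.inv₀
    ((contDiffOn_volDensity he).continuousOn.comp e.continuousOn hmaps)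
    fun x hx ↦ (volDensity_pos he (hmaps hx)).ne') ?_
  refine continuousOn_finsetSum _ fun i _ ↦ ?_
  have hV : ContDiffOn ℝ 1 (fun y ↦ volDensity e y * components e X y i) e.target :=
    ((contDiffOn_volDensity he).of_le (by simp)).mul ((contDiffOn_euclidean.1 hX) i)
  exact ((hV.continuousOn_fderiv_of_isOpen e.open_target le_rfl).clm_apply
    continuousOn_const).comp e.continuousOn hmaps

/-- A weak argument replaces the coordinate computation. For a test function `g` supported in the
overlap, the chart divergence theorem with `χ = 1` holds in both charts; subtracting shows that the
difference of the two divergences integrates to zero against `g`. That difference is continuous,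
hence zero. -/
theorem divergenceInChart_eq [ProperSpace M] (hX : ∀ e ∈ atlas (EuclideanSpace ℝ (Fin d)) M,
      ContDiffOn ℝ 1 (components e X) e.target)
    (he : e ∈ atlas (EuclideanSpace ℝ (Fin d)) M) (he' : e' ∈ atlas (EuclideanSpace ℝ (Fin d)) M)
    {x : M} (hx : x ∈ e.source) (hx' : x ∈ e'.source) :
    divergenceInChart e X x = divergenceInChart e' X x := by
  borelize M
  have := riemannianVolume_isLocallyFinite (d := d) (M := M)
  have := riemannianVolume_isOpenPos (d := d) (M := M)
  set U := e.source ∩ e'.source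
  have hU : IsOpen U := e.open_source.inter e'.open_source
  have hc : ContinuousOn (divergenceInChart e X) U :=
    (continuousOn_divergenceInChart he (hX e he)).mono Set.inter_subset_left
  have hc' : ContinuousOn (divergenceInChart e' X) U :=
    (continuousOn_divergenceInChart he' (hX e' he')).mono Set.inter_subset_right
  have hae : ∀ᵐ z ∂(riemannianVolume d M), z ∈ U →
      divergenceInChart e X z - divergenceInChart e' X z = 0 := by
    refine hU.ae_eq_zero_of_integral_contMDiff_smul_eq_zero (𝓡 d)
      ((hc.sub hc').locallyIntegrableOn hU.measurableSet) fun g hg hgc hgU ↦ ?_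
    have hg0 : ∀ z ∉ tsupport g, g z = 0 := fun z hz ↦ image_eq_zero_of_notMem_tsupport hz
    have hK : LipschitzWith 0 fun _ : M ↦ (1 : ℝ) := LipschitzWith.const 1
    have hg1 : ContMDiff (𝓡 d) 𝓘(ℝ, ℝ) 1 g := hg.of_le (by simp)
    obtain ⟨h1, h2⟩ := integral_divIntegrand_eq_zero he (hX e he) hK hg1 hgc
      (hgU.trans Set.inter_subset_left) hg0
    obtain ⟨h1', h2'⟩ := integral_divIntegrand_eq_zero he' (hX e' he') hK hg1 hgc
      (hgU.trans Set.inter_subset_right) hg0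
    have h3 := integral_sub h1 h1'
    rw [h2, h2', sub_zero] at h3
    rw [← h3]
    refine integral_congr_ae (ae_of_all _ fun z ↦ ?_)
    simp only [divIntegrand, smul_eq_mul]
    ring
  have h := Measure.eqOn_open_of_ae_eq (μ := riemannianVolume d M)
    (f := fun z ↦ divergenceInChart e X z - divergenceInChart e' X z) (g := fun _ ↦ 0)
    ((ae_restrict_iff' hU.measurableSet).2 hae) hU (hc.sub hc') continuousOn_const
  exact sub_eq_zero.1 (h ⟨hx, hx'⟩)

theorem divergence_eq_divergenceInChart [ProperSpace M]
    (hX : ∀ e ∈ atlas (EuclideanSpace ℝ (Fin d)) M, ContDiffOn ℝ 1 (components e X) e.target)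
    (he : e ∈ atlas (EuclideanSpace ℝ (Fin d)) M) {x : M} (hx : x ∈ e.source) :
    divergence X x = divergenceInChart e X x :=
  divergenceInChart_eq hX (chart_mem_atlas _ x) he (mem_chart_source _ x) hx

variable [MeasurableSpace M] [BorelSpace M]

/-- The divergence theorem for a vector field `χ h X`, where `X` and `h` are `C¹` and `χ` is
Lipschitz with compact support. -/
theorem integral_divergence_eq_zero [ProperSpace M]
    (hX : ∀ e ∈ atlas (EuclideanSpace ℝ (Fin d)) M, ContDiffOn ℝ 1 (components e X) e.target)
    {χ : M → ℝ} {K : NNReal} (hχ : LipschitzWith K χ) (hχc : HasCompactSupport χ) {h : M → ℝ}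
    (hh : ContMDiff (𝓡 d) 𝓘(ℝ, ℝ) 1 h) :
    Integrable (fun x ↦ h x * derivAlong χ X x + χ x * derivAlong h X x +
        χ x * h x * divergence X x) (riemannianVolume d M) ∧
      ∫ x, (h x * derivAlong χ X x + χ x * derivAlong h X x +
        χ x * h x * divergence X x) ∂(riemannianVolume d M) = 0 := by
  -- Closed balls inside chart domains are compact, and serve as the sets `S` of the one-chart
  -- theorem.
  have hr : ∀ x : M, ∃ r > 0,
      Metric.closedBall x r ⊆ (chartAt (EuclideanSpace ℝ (Fin d)) x).source := fun x ↦
    Metric.nhds_basis_closedBall.mem_iff.1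
      ((chartAt (EuclideanSpace ℝ (Fin d)) x).open_source.mem_nhds (mem_chart_source _ x))
  choose r hr0 hr using hr
  obtain ⟨t, ht⟩ := IsCompact.elim_finite_subcover (ι := M) hχc (fun x ↦ Metric.ball x (r x))
    (fun x ↦ Metric.isOpen_ball) fun x _ ↦ Set.mem_iUnion.2 ⟨x, Metric.mem_ball_self (hr0 x)⟩
  obtain ⟨ρ, hρ⟩ := SmoothPartitionOfUnity.exists_isSubordinate (𝓡 d) (isClosed_tsupport χ)
    (fun i : t ↦ Metric.ball (i : M) (r i)) (fun i ↦ Metric.isOpen_ball)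
    (by simpa [Set.iUnion_subtype] using ht)
  have hρ1 : ∀ i, ContMDiff (𝓡 d) 𝓘(ℝ, ℝ) 1 fun z ↦ ρ i z * h z := fun i ↦
    ((ρ i).contMDiff.of_le (by simp)).mul hh
  have hsum : ∀ x ∈ tsupport χ, ∑ i, ρ i x = 1 := fun x hx ↦ by
    rw [← finsum_eq_sum_of_fintype]
    exact ρ.sum_eq_one hx
  have hρ0 : ∀ i : t, ∀ x ∉ Metric.closedBall (i : M) (r i), ρ i x = 0 := fun i x hx ↦
    image_eq_zero_of_notMem_tsupport fun hx' ↦ hx (Metric.ball_subset_closedBall (hρ i hx'))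
  have key : ∀ i : t, Integrable (divIntegrand (chartAt _ (i : M)) X χ fun z ↦ ρ i z * h z)
        (riemannianVolume d M) ∧
      ∫ x, divIntegrand (chartAt _ (i : M)) X χ (fun z ↦ ρ i z * h z) x
        ∂(riemannianVolume d M) = 0 := fun i ↦
    integral_divIntegrand_eq_zero (chart_mem_atlas _ (i : M)) (hX _ (chart_mem_atlas _ (i : M)))
      hχ (hρ1 i) (isCompact_closedBall (i : M) (r i)) (hr i)
      fun x hx ↦ by rw [hρ0 i x hx, zero_mul]
  have hT : (fun x ↦ h x * derivAlong χ X x + χ x * derivAlong h X x +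
        χ x * h x * divergence X x) =
      fun x ↦ ∑ i : t, divIntegrand (chartAt _ (i : M)) X χ (fun z ↦ ρ i z * h z) x := by
    ext x
    simp only [divIntegrand, Finset.sum_add_distrib]
    by_cases hx : x ∈ tsupport χ
    · have h1 : ∑ i, ρ i x * h x * derivAlong χ X x = h x * derivAlong χ X x := by
        simp_rw [mul_assoc]
        rw [← Finset.sum_mul, hsum x hx, one_mul]
      -- The `ρ i` sum to `1` only on the support of `χ`. Where `χ x ≠ 0` this holds near `x`, so
      -- derivatives agree; where `χ x = 0` the factor kills both sides.
      have h2 : ∑ i, χ x * derivAlong (fun z ↦ ρ i z * h z) X x = χ x * derivAlong h X x := by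
        rw [← Finset.mul_sum, ← derivAlong_sum _ fun i _ ↦ hρ1 i]
        by_cases hχx : χ x = 0
        · rw [hχx, zero_mul, zero_mul]
        · congr 1
          refine derivAlong_congr ?_
          filter_upwards [hχ.continuous.continuousAt.eventually_ne hχx] with z hz
          rw [← Finset.sum_mul, hsum z (subset_tsupport _ hz), one_mul]
      have h3 : ∑ i : t, χ x * (ρ i x * h x) * divergenceInChart (chartAt _ (i : M)) X x =
          χ x * h x * divergence X x := by
        calc _ = ∑ i, ρ i x * (χ x * h x * divergence X x) := by
              refine Finset.sum_congr rfl fun i _ ↦ ?_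
              by_cases hi : x ∈ (chartAt (EuclideanSpace ℝ (Fin d)) (i : M)).source
              · rw [divergence_eq_divergenceInChart hX (chart_mem_atlas _ (i : M)) hi]
                ring
              · rw [hρ0 i x fun h ↦ hi (hr i h)]
                ring
          _ = _ := by rw [← Finset.sum_mul, hsum x hx, one_mul]
      rw [h1, h2, h3]
    · have h0 : χ x = 0 := image_eq_zero_of_notMem_tsupport hx
      have h1 : derivAlong χ X x = 0 := by
        rw [derivAlong_congr (notMem_tsupport_iff_eventuallyEq.1 hx)]
        exact derivAlong_const 0
      simp [h0, h1]
  rw [hT]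
  refine ⟨integrable_finsetSum _ fun i _ ↦ (key i).1, ?_⟩
  rw [integral_finsetSum _ fun i _ ↦ (key i).1]
  exact Finset.sum_eq_zero fun i _ ↦ (key i).2

end WeightedManifold

/-! ### Real inequalities behind the estimate. -/

section RealInequalities

/-- A Young inequality proved by cases. If `A ≤ η φ² w^t`, the left side is at most the first term.
Otherwise `φ² w^t < A / η`, and the condition on `k` with `φ ≤ 1` gives `φ^k w^(t+1) ≤ (φ²
w^t)^((t+1)/t)`. -/
theorem mul_pow_mul_rpow_le {t A η : ℝ} (ht : 0 < t) (hA : 0 < A) (hη : 0 < η) {k : ℕ}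
    (hk : 2 * (t + 1) / t ≤ k) {φ w : ℝ} (hφ0 : 0 ≤ φ) (hφ1 : φ ≤ 1) (hw : 1 ≤ w) :
    A * φ ^ k * w ^ (t + 1) ≤
      η * φ ^ (k + 2) * w ^ (2 * t + 1) + A * (A / η) ^ ((t + 1) / t) := by
  have hw0 : 0 < w := by linarith
  rcases le_or_gt A (η * φ ^ 2 * w ^ t) with h | h
  · have h1 : A * φ ^ k * w ^ (t + 1) ≤ (η * φ ^ 2 * w ^ t) * φ ^ k * w ^ (t + 1) := by gcongr
    have h2 : (η * φ ^ 2 * w ^ t) * φ ^ k * w ^ (t + 1) = η * φ ^ (k + 2) * w ^ (2 * t + 1) := by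
      rw [show 2 * t + 1 = t + (t + 1) by ring, Real.rpow_add hw0 t (t + 1)]
      ring
    have h3 : 0 ≤ A * (A / η) ^ ((t + 1) / t) := by positivity
    linarith
  · have h1 : φ ^ 2 * w ^ t ≤ A / η := by
      rw [le_div_iff₀ hη]
      linarith
    have h2 : φ ^ k * w ^ (t + 1) ≤ (A / η) ^ ((t + 1) / t) := by
      calc φ ^ k * w ^ (t + 1) ≤ φ ^ (2 * (t + 1) / t) * w ^ (t + 1) := by
            gcongr
            rw [← Real.rpow_natCast]
            exact Real.rpow_le_rpow_of_exponent_ge' hφ0 hφ1 (by positivity) hk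
        _ = (φ ^ 2 * w ^ t) ^ ((t + 1) / t) := by
            rw [Real.mul_rpow (by positivity) (by positivity), ← Real.rpow_natCast φ 2,
              ← Real.rpow_mul hφ0, ← Real.rpow_mul hw0.le]
            congr 2
            · push_cast
              ring
            · field_simp
        _ ≤ _ := by gcongr
    have h3 : 0 ≤ η * φ ^ (k + 2) * w ^ (2 * t + 1) := by positivity
    nlinarith

/-- The pointwise inequality behind the a priori estimate: `s` stands for the solution, `g` for the
norm of its gradient, `D` for the derivative of the cutoff function `φ ^ (k + 2)` along the
gradient of the solution. -/
theorem exists_pointwise_bound {t : ℝ} (ht : 0 < t) : ∃ (k : ℕ) (C : ℝ), 0 < C ∧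
    ∀ (R l : ℝ), 0 < R → 0 < l → l ^ (2 * t) = R ^ 2 → ∀ (s g φ D : ℝ), 0 ≤ s → 0 ≤ φ → φ ≤ 1 →
      0 ≤ g → |D| ≤ R⁻¹ * (k + 2) * φ ^ (k + 1) * g →
      (1 + (l * s + 1) ^ (-t)) * D + φ ^ (k + 2) * (-t * l * (l * s + 1) ^ (-t - 1) * g ^ 2) -
        φ ^ (k + 2) * (1 + (l * s + 1) ^ (-t)) * s ^ (2 * t + 1) ≤
      -(1 / 2) * (φ ^ (k + 2) * s ^ (2 * t + 1)) + C * l ^ (-(2 * t + 1)) := by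
  obtain ⟨k, hk⟩ := exists_nat_ge (2 * (t + 1) / t)
  set A₀ : ℝ := (k + 2) ^ 2 / t with hA₀
  have hA₀pos : 0 < A₀ := by positivity
  -- The power of `2` cancels the constant in `w^(2t+1) ≤ 2^(2t+1) ((l s)^(2t+1) + 1)`, so that
  -- exactly half of the term in `s^(2t+1)` is spent.
  set η : ℝ := 1 / 2 * (2 : ℝ) ^ (-(2 * t + 1)) with hη
  have hηpos : 0 < η := by positivity
  refine ⟨k, A₀ * (A₀ / η) ^ ((t + 1) / t) + 1 / 2, by positivity, ?_⟩
  intro R l hR hl hRl s g φ D hs hφ0 hφ1 hg hD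
  set w := l * s + 1 with hw
  have hls : 0 ≤ l * s := by positivity
  have hw1 : 1 ≤ w := by linarith
  have hw0 : 0 < w := by linarith
  set c : ℝ := R⁻¹ * (k + 2) with hc
  set a : ℝ := t * l * w ^ (-t - 1) with ha
  have ha0 : 0 < a := by positivity
  have hF1 : 0 ≤ w ^ (-t) := by positivity
  have hF2 : w ^ (-t) ≤ 1 := Real.rpow_le_one_of_one_le_of_nonpos hw1 (by linarith)
  -- the term containing `D` is absorbed by the term containing `g ^ 2`
  have h1 : (1 + w ^ (-t)) * D ≤ 2 * (c * φ ^ (k + 1) * g) := by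
    calc (1 + w ^ (-t)) * D ≤ (1 + w ^ (-t)) * |D| := by gcongr; exact le_abs_self _
      _ ≤ 2 * (c * φ ^ (k + 1) * g) := by
        gcongr
        linarith
  have h2 : 2 * (c * φ ^ (k + 1) * g) ≤ φ ^ (k + 2) * (a * g ^ 2) + φ ^ k * (c ^ 2 / a) := by
    have : φ ^ (k + 2) * (a * g ^ 2) + φ ^ k * (c ^ 2 / a) - 2 * (c * φ ^ (k + 1) * g) =
        φ ^ k * (a * (φ * g - c / a) ^ 2) := by
      field_simp
      ring
    have h0 : 0 ≤ φ ^ k * (a * (φ * g - c / a) ^ 2) := by positivity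
    linarith
  have hlp : l ^ (-(2 * t + 1)) = (l * R ^ 2)⁻¹ := by
    rw [Real.rpow_neg hl.le, Real.rpow_add hl, Real.rpow_one, hRl, mul_comm]
  -- The relation `l^(2t) = R²` turns `R⁻² / l` into `l^(-(2t+1))`; the remaining constant `(k + 2)²
  -- / t` is `A₀`.
  have h3 : φ ^ k * (c ^ 2 / a) = l ^ (-(2 * t + 1)) * (A₀ * φ ^ k * w ^ (t + 1)) := by
    rw [hlp, hA₀, ha, hc, show -t - 1 = -(t + 1) by ring, Real.rpow_neg hw0.le]
    have : 0 < w ^ (t + 1) := by positivity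
    field_simp
  have h4 := mul_pow_mul_rpow_le ht hA₀pos hηpos hk hφ0 hφ1 hw1
  have h5 : w ^ (2 * t + 1) ≤ 2 ^ (2 * t + 1) * (l ^ (2 * t + 1) * s ^ (2 * t + 1) + 1) := by
    have hle : w ≤ 2 * max (l * s) 1 := by
      linarith [le_max_left (l * s) 1, le_max_right (l * s) 1]
    calc w ^ (2 * t + 1) ≤ (2 * max (l * s) 1) ^ (2 * t + 1) := by gcongr
      _ = 2 ^ (2 * t + 1) * (max (l * s) 1) ^ (2 * t + 1) :=
        Real.mul_rpow (by norm_num) (by positivity)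
      _ ≤ _ := by
        gcongr
        rcases max_cases (l * s) 1 with h | h
        · rw [h.1, Real.mul_rpow hl.le hs]
          linarith
        · rw [h.1, Real.one_rpow]
          have : 0 ≤ l ^ (2 * t + 1) * s ^ (2 * t + 1) := by positivity
          linarith
  have h6 : l ^ (-(2 * t + 1)) * (η * φ ^ (k + 2) * w ^ (2 * t + 1)) ≤
      1 / 2 * (φ ^ (k + 2) * s ^ (2 * t + 1)) + 1 / 2 * l ^ (-(2 * t + 1)) := by
    have hl1 : l ^ (-(2 * t + 1)) * l ^ (2 * t + 1) = 1 := by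
      rw [← Real.rpow_add hl]
      simp
    have h21 : (2 : ℝ) ^ (-(2 * t + 1)) * 2 ^ (2 * t + 1) = 1 := by
      rw [← Real.rpow_add (by norm_num)]
      simp
    have hφk : φ ^ (k + 2) ≤ 1 := pow_le_one₀ hφ0 hφ1
    calc l ^ (-(2 * t + 1)) * (η * φ ^ (k + 2) * w ^ (2 * t + 1))
        ≤ l ^ (-(2 * t + 1)) * (η * φ ^ (k + 2) *
          (2 ^ (2 * t + 1) * (l ^ (2 * t + 1) * s ^ (2 * t + 1) + 1))) := by gcongr
      _ = 1 / 2 * φ ^ (k + 2) * ((2 : ℝ) ^ (-(2 * t + 1)) * 2 ^ (2 * t + 1)) *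
          ((l ^ (-(2 * t + 1)) * l ^ (2 * t + 1)) * s ^ (2 * t + 1) + l ^ (-(2 * t + 1))) := by
        rw [hη]
        ring
      _ = 1 / 2 * (φ ^ (k + 2) * s ^ (2 * t + 1)) +
          1 / 2 * (φ ^ (k + 2) * l ^ (-(2 * t + 1))) := by
        rw [hl1, h21]
        ring
      _ ≤ _ := by
        gcongr
        exact mul_le_of_le_one_left (by positivity) hφk
  have h7 : φ ^ k * (c ^ 2 / a) ≤ l ^ (-(2 * t + 1)) * (η * φ ^ (k + 2) * w ^ (2 * t + 1)) +
      l ^ (-(2 * t + 1)) * (A₀ * (A₀ / η) ^ ((t + 1) / t)) := by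
    rw [h3, ← mul_add]
    gcongr
  -- Only the summand `1` of `1 + w^(-t)` is used in the reaction term; this part has a favourable
  -- sign and is dropped.
  have h8 : 0 ≤ φ ^ (k + 2) * w ^ (-t) * s ^ (2 * t + 1) := by positivity
  have h9 : φ ^ (k + 2) * (-t * l * w ^ (-t - 1) * g ^ 2) = -(φ ^ (k + 2) * (a * g ^ 2)) := by
    rw [ha]
    ring
  rw [h9]
  linarith

end RealInequalities

/-! ### From local Lipschitz bounds to derivative bounds. -/

namespace WeightedManifold

variable {d : ℕ} {M : Type*} [MetricSpace M] [ChartedSpace (EuclideanSpace ℝ (Fin d)) M]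
  [IsManifold (𝓡 d) ∞ M] [RiemannianBundle (fun x : M ↦ TangentSpace (𝓡 d) x)]
  [IsContMDiffRiemannianBundle (𝓡 d) ∞ (EuclideanSpace ℝ (Fin d))
      (fun x : M ↦ TangentSpace (𝓡 d) x)]
  [IsRiemannianManifold (𝓡 d) M]

/-- A function which near `x` is almost `L`-Lipschitz with respect to `x` has derivative of norm at
most `L` at `x`. -/
theorem abs_derivAlong_le {X : ∀ x : M, TangentSpace (𝓡 d) x} {χ : M → ℝ} {x : M} {L : ℝ}
    (hL : 0 ≤ L) (h : ∀ L' > L, ∀ᶠ z in 𝓝 x, |χ z - χ x| ≤ L' * dist z x) :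
    |derivAlong χ X x| ≤ L * ‖X x‖ := by
  by_cases hd : MDifferentiableAt (𝓡 d) 𝓘(ℝ, ℝ) χ x
  swap
  · have : derivAlong χ X x = 0 := by
      rw [derivAlong, mfderiv_zero_of_not_mdifferentiableAt hd]
      rfl
    rw [this, abs_zero]
    positivity
  obtain ⟨e, he, hxe⟩ : ∃ e ∈ atlas (EuclideanSpace ℝ (Fin d)) M, x ∈ e.source :=
    ⟨_, chart_mem_atlas _ x, mem_chart_source _ x⟩
  obtain ⟨y, hy, rfl⟩ : ∃ y ∈ e.target, e.symm y = x := ⟨e x, e.map_source hxe, e.left_inv hxe⟩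
  set v := components e X y with hv
  set N : EuclideanSpace ℝ (Fin d) → ℝ := fun z ↦
    ‖(mfderiv (𝓡 d) (𝓡 d) e.symm z v : TangentSpace (𝓡 d) (e.symm z))‖ with hN
  have hNy : N y = ‖X (e.symm y)‖ := by
    simp only [hN, hv]
    rw [mfderiv_chart_symm_components he X hy]
  have hNc : ContinuousAt N y := by
    have h1 : ∀ z, N z = √(∑ i, ∑ j, v i * v j * metricMatrix e z i j) := fun z ↦ by
      rw [← inner_mfderiv_chart_symm, ← norm_eq_sqrt_real_inner]
    rw [show N = fun z ↦ √(∑ i, ∑ j, v i * v j * metricMatrix e z i j) from funext h1]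
    refine ContinuousOn.continuousAt (s := e.target) ?_ (e.open_target.mem_nhds hy)
    exact (continuousOn_finsetSum _ fun i _ ↦ continuousOn_finsetSum _ fun j _ ↦
      continuousOn_const.mul (contDiffOn_metricMatrix he i j).continuousOn).sqrt
  have hχd : DifferentiableAt ℝ (χ ∘ e.symm) y :=
    (hd.comp y (mdifferentiableAt_chart_symm he hy)).differentiableAt
  have hderiv : HasDerivAt (fun s : ℝ ↦ χ (e.symm (y + s • v))) (derivAlong χ X (e.symm y)) 0 := by
    have h1 : derivAlong χ X (e.symm y) = fderiv ℝ (χ ∘ e.symm) y v :=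
      mfderiv_apply_eq_fderiv_components he hy hd X
    rw [h1]
    have h2 := hχd.hasFDerivAt.hasLineDerivAt v
    exact h2
  -- Move from `y` along the coordinate line in direction `v`: near `y` its speed in `M` is at most
  -- `‖X‖ + δ` and the Lipschitz ratio of `χ` at most `L + δ`. Then `δ → 0`.
  have key : ∀ δ > 0, |derivAlong χ X (e.symm y)| ≤ (L + δ) * (‖X (e.symm y)‖ + δ) := by
    intro δ hδ
    rw [← Real.norm_eq_abs]
    refine hderiv.le_of_lip' (by positivity) ?_
    have hev : ∀ᶠ z in 𝓝 y, z ∈ e.target ∧ N z < ‖X (e.symm y)‖ + δ :=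
      (e.open_target.eventually_mem hy).and (hNc.eventually_lt_const (by rw [hNy]; linarith))
    obtain ⟨r, hr, hball⟩ := Metric.eventually_nhds_iff_ball.1 hev
    have hcont : Continuous fun s : ℝ ↦ y + s • v := by fun_prop
    have hcs : ContinuousAt (fun s : ℝ ↦ e.symm (y + s • v)) 0 := by
      refine ContinuousAt.comp (f := fun s : ℝ ↦ y + s • v) (g := e.symm) ?_ hcont.continuousAt
      simpa using e.continuousAt_symm hy
    have hs1 : ∀ᶠ s in 𝓝 (0 : ℝ), y + s • v ∈ Metric.ball y r :=
      hcont.continuousAt.eventually_mem (by simpa using Metric.ball_mem_nhds y hr)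
    have hs2 : ∀ᶠ s in 𝓝 (0 : ℝ), |χ (e.symm (y + s • v)) - χ (e.symm y)| ≤
        (L + δ) * dist (e.symm (y + s • v)) (e.symm y) := by
      have := h (L + δ) (by linarith)
      rw [show e.symm y = e.symm (y + (0 : ℝ) • v) by simp] at this
      simpa using hcs.eventually this
    filter_upwards [hs1, hs2] with s hs1 hs2
    have hseg : ∀ t ∈ Set.Icc (0 : ℝ) 1, y + t • s • v ∈ Metric.ball y r := by
      intro t ht
      have := (convex_ball y r).add_smul_sub_mem (Metric.mem_ball_self hr) hs1 ht
      simpa using this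
    have hdist := dist_symm_le_of_segment he (C := |s| * (‖X (e.symm y)‖ + δ))
      (fun t ht ↦ (hball _ (hseg t ht)).1) fun t ht ↦ by
        have h1 := (hball _ (hseg t ht)).2.le
        have h2 : ‖(mfderiv (𝓡 d) (𝓡 d) e.symm (y + t • s • v) (s • v) :
            TangentSpace (𝓡 d) (e.symm (y + t • s • v)))‖ = |s| * N (y + t • s • v) := by
          rw [← Real.norm_eq_abs, ← norm_smul]
          congr 1
          exact map_smul (mfderiv (𝓡 d) (𝓡 d) e.symm (y + t • s • v)) s v
        refine h2.le.trans ?_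
        gcongr
    rw [Real.norm_eq_abs, Real.norm_eq_abs, sub_zero, zero_smul, add_zero]
    calc _ ≤ (L + δ) * dist (e.symm (y + s • v)) (e.symm y) := hs2
      _ ≤ (L + δ) * (|s| * (‖X (e.symm y)‖ + δ)) := by
        rw [dist_comm]
        gcongr
      _ = _ := by ring
  have hlim : Tendsto (fun δ : ℝ ↦ (L + δ) * (‖X (e.symm y)‖ + δ)) (𝓝[>] 0)
      (𝓝 (L * ‖X (e.symm y)‖)) := by
    have : Continuous fun δ : ℝ ↦ (L + δ) * (‖X (e.symm y)‖ + δ) := by fun_prop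
    simpa using (this.tendsto 0).mono_left nhdsWithin_le_nhds
  refine ge_of_tendsto hlim ?_
  filter_upwards [self_mem_nhdsWithin] with δ hδ using key δ hδ

theorem derivAlong_grad_self (w : M → ℝ) (x : M) :
    derivAlong w (fun z ↦ grad d w z) x = ‖grad d w x‖ ^ 2 := by
  rw [← real_inner_self_eq_norm_sq, inner_grad]
  rfl

end WeightedManifold

/-! ### Cutoff functions and the a priori estimate. -/

namespace WeightedManifold

variable {d : ℕ} {M : Type*} [MetricSpace M] [ChartedSpace (EuclideanSpace ℝ (Fin d)) M]
  [IsManifold (𝓡 d) ∞ M] [RiemannianBundle (fun x : M ↦ TangentSpace (𝓡 d) x)]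
  [IsContMDiffRiemannianBundle (𝓡 d) ∞ (EuclideanSpace ℝ (Fin d))
      (fun x : M ↦ TangentSpace (𝓡 d) x)]
  [IsRiemannianManifold (𝓡 d) M] [MeasurableSpace M] [BorelSpace M]

/-- The cutoff function equal to `1` on the ball of radius `R` and to `0` off the ball of radius
`2 R`. -/
noncomputable def cutoff (o : M) (R : ℝ) (x : M) : ℝ :=
  max 0 (min 1 (2 - R⁻¹ * dist x o))

theorem cutoff_nonneg (o : M) (R : ℝ) (x : M) : 0 ≤ cutoff o R x := le_max_left _ _

theorem cutoff_le_one (o : M) (R : ℝ) (x : M) : cutoff o R x ≤ 1 :=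
  max_le zero_le_one (min_le_left _ _)

theorem cutoff_eq_zero {o : M} {R : ℝ} (hR : 0 < R) {x : M} (hx : x ∉ Metric.ball o (2 * R)) :
    cutoff o R x = 0 := by
  rw [Metric.mem_ball, not_lt] at hx
  have : 2 ≤ R⁻¹ * dist x o := by
    rw [inv_mul_eq_div, le_div_iff₀ hR]
    exact hx
  exact max_eq_left ((min_le_right _ _).trans (by linarith))

theorem cutoff_eq_one {o : M} {R : ℝ} (hR : 0 < R) {x : M} (hx : x ∈ Metric.ball o R) :
    cutoff o R x = 1 := by
  rw [Metric.mem_ball] at hx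
  have : R⁻¹ * dist x o ≤ 1 := by
    rw [inv_mul_eq_div, div_le_one hR]
    exact hx.le
  rw [cutoff, min_eq_left (by linarith), max_eq_right zero_le_one]

theorem abs_cutoff_sub_le (o : M) {R : ℝ} (hR : 0 < R) (x z : M) :
    |cutoff o R z - cutoff o R x| ≤ R⁻¹ * dist z x := by
  have h1 : |cutoff o R z - cutoff o R x| ≤ |min 1 (2 - R⁻¹ * dist z o) -
      min 1 (2 - R⁻¹ * dist x o)| := abs_max_sub_max_le_abs _ _ _ |>.trans_eq' (by
        rw [cutoff, cutoff, max_comm 0, max_comm 0])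
  have h2 : |min 1 (2 - R⁻¹ * dist z o) - min 1 (2 - R⁻¹ * dist x o)| ≤
      |(2 - R⁻¹ * dist z o) - (2 - R⁻¹ * dist x o)| := by
    refine (abs_min_sub_min_le_max _ _ _ _).trans ?_
    simp
  refine (h1.trans h2).trans ?_
  rw [show (2 - R⁻¹ * dist z o) - (2 - R⁻¹ * dist x o) = R⁻¹ * (dist x o - dist z o) by ring,
    abs_mul, abs_of_pos (inv_pos.2 hR), dist_comm z x]
  gcongr
  exact abs_dist_sub_le x z o

theorem continuous_cutoff (o : M) (R : ℝ) : Continuous (cutoff o R) := by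
  unfold cutoff
  fun_prop

/-- The factor with exponent `n` is kept, since the estimate needs the derivative of a power of the
cutoff to carry the next lower power. -/
theorem abs_cutoff_pow_sub_le (o : M) {R : ℝ} (hR : 0 < R) (n : ℕ) (x z : M) :
    |cutoff o R z ^ (n + 1) - cutoff o R x ^ (n + 1)| ≤
      R⁻¹ * (n + 1) * max (cutoff o R z) (cutoff o R x) ^ n * dist z x := by
  have h := abs_pow_sub_pow_le (cutoff o R z) (cutoff o R x) (n + 1)
  rw [abs_of_nonneg (cutoff_nonneg o R z), abs_of_nonneg (cutoff_nonneg o R x)] at h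
  refine h.trans ?_
  have h2 := abs_cutoff_sub_le o hR x z
  have h3 : 0 ≤ max (cutoff o R z) (cutoff o R x) := le_max_of_le_left (cutoff_nonneg o R z)
  calc _ ≤ R⁻¹ * dist z x * ((n + 1 : ℕ) : ℝ) *
        max (cutoff o R z) (cutoff o R x) ^ (n + 1 - 1) := by gcongr
    _ = _ := by
      rw [Nat.add_sub_cancel]
      push_cast
      ring

theorem lipschitzWith_cutoff_pow (o : M) {R : ℝ} (hR : 0 < R) (n : ℕ) :
    LipschitzWith (R⁻¹ * (n + 1)).toNNReal fun x ↦ cutoff o R x ^ (n + 1) := by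
  refine LipschitzWith.of_dist_le_mul fun z x ↦ ?_
  rw [Real.coe_toNNReal _ (by positivity), Real.dist_eq]
  refine (abs_cutoff_pow_sub_le o hR n x z).trans ?_
  refine mul_le_mul_of_nonneg_right ?_ dist_nonneg
  exact mul_le_of_le_one_right (by positivity) (pow_le_one₀
    (le_max_of_le_left (cutoff_nonneg o R z)) (max_le (cutoff_le_one o R z) (cutoff_le_one o R x)))

/-- As `z → x` the maximum in the difference bound tends to `cutoff o R x`, so any constant above
the limiting one works near `x`. -/
theorem abs_derivAlong_cutoff_pow_le (o : M) {R : ℝ} (hR : 0 < R) (n : ℕ)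
    (X : ∀ x : M, TangentSpace (𝓡 d) x) (x : M) :
    |derivAlong (fun z ↦ cutoff o R z ^ (n + 1)) X x| ≤
      R⁻¹ * (n + 1) * cutoff o R x ^ n * ‖X x‖ := by
  have h0 := cutoff_nonneg o R x
  refine abs_derivAlong_le (by positivity) fun L' hL' ↦ ?_
  have hc : Continuous fun z ↦ R⁻¹ * (n + 1) * max (cutoff o R z) (cutoff o R x) ^ n := by
    have := continuous_cutoff o R
    fun_prop
  have hev : ∀ᶠ z in 𝓝 x, R⁻¹ * (n + 1) * max (cutoff o R z) (cutoff o R x) ^ n < L' :=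
    hc.continuousAt.eventually_lt_const (by simpa using hL')
  filter_upwards [hev] with z hz
  refine (abs_cutoff_pow_sub_le o hR n x z).trans ?_
  gcongr

section Estimate

variable [ProperSpace M] {f u : M → ℝ}

/-- The a priori estimate for the equation `-ℒu = u ^ (2 t + 1)`. -/
theorem exists_integral_le (hf : ContMDiff (𝓡 d) 𝓘(ℝ, ℝ) 1 f) (hu : ContMDiff (𝓡 d) 𝓘(ℝ, ℝ) 2 u)
    (hu0 : ∀ x, 0 ≤ u x) {t : ℝ} (ht : 0 < t)
    (hueq : ∀ x, -weightedLaplacian d f u x = u x ^ (2 * t + 1)) (o : M) :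
    ∃ C > 0, ∀ R > 0, ∫ x in Metric.ball o R, Real.exp (-f x) * u x ^ (2 * t + 1)
        ∂(riemannianVolume d M) ≤
      C * R ^ (-((2 * t + 1) / t)) * (weightedMeasure d f (Metric.ball o (2 * R))).toReal := by
  have := riemannianVolume_isLocallyFinite (d := d) (M := M)
  obtain ⟨k, C, hC, hpt⟩ := exists_pointwise_bound ht
  refine ⟨2 * C, by positivity, fun R hR ↦ ?_⟩
  set ν := riemannianVolume d M
  set X : ∀ x : M, TangentSpace (𝓡 d) x := fun z ↦ grad d u z
  have hX : ∀ e ∈ atlas (EuclideanSpace ℝ (Fin d)) M, ContDiffOn ℝ 1 (components e X) e.target :=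
    fun e he ↦ contDiffOn_components_grad he (n := 1) (w := u)
      (hu.of_le (by norm_num [one_add_one_eq_two]))
  -- This scale makes `l⁻¹` the size of `u` dictated by the scaling of the equation, and `l^(-p)`
  -- becomes `R^(-2p/(p-1))`.
  set l : ℝ := R ^ (1 / t) with hl
  have hl0 : 0 < l := by positivity
  have hlR : l ^ (2 * t) = R ^ 2 := by
    rw [hl, ← Real.rpow_mul hR.le, show 1 / t * (2 * t) = (2 : ℕ) by push_cast; field_simp,
      Real.rpow_natCast]
  have hlC : l ^ (-(2 * t + 1)) = R ^ (-((2 * t + 1) / t)) := by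
    rw [hl, ← Real.rpow_mul hR.le]
    congr 1
    ring
  set φ := cutoff o R
  set χ : M → ℝ := fun x ↦ φ x ^ (k + 2)
  set Φ : ℝ → ℝ := fun s ↦ 1 + (l * s + 1) ^ (-t)
  set Φ' : ℝ → ℝ := fun s ↦ -t * l * (l * s + 1) ^ (-t - 1)
  set B := Metric.ball o (2 * R)
  have hu1 : ContMDiff (𝓡 d) 𝓘(ℝ, ℝ) 1 u := hu.of_le (by norm_num)
  have hpos : ∀ x, 0 < l * u x + 1 := fun x ↦ by
    have := hu0 x
    positivity
  have hχ0 : ∀ x ∉ B, χ x = 0 := fun x hx ↦ by simp [χ, φ, cutoff_eq_zero hR hx]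
  have hχc : HasCompactSupport χ := HasCompactSupport.intro (isCompact_closedBall o (2 * R))
    fun x hx ↦ hχ0 x fun h ↦ hx (Metric.ball_subset_closedBall h)
  have hχcont : Continuous χ := (continuous_cutoff o R).pow _
  have hΦd : ∀ x, HasDerivAt Φ (Φ' (u x)) (u x) := by
    intro x
    have h1 : HasDerivAt (fun s : ℝ ↦ l * s + 1) l (u x) := by
      simpa using ((hasDerivAt_id (u x)).const_mul l).add_const 1
    have h2 := (h1.rpow_const (p := -t) (Or.inl (hpos x).ne')).const_add 1
    have h3 : l * -t * (l * u x + 1) ^ (-t - 1) = Φ' (u x) := by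
      simp only [Φ']
      ring
    exact h3 ▸ h2
  have hΦu : ContMDiff (𝓡 d) 𝓘(ℝ, ℝ) 1 fun x ↦ Φ (u x) := by
    intro x
    have hc : ContDiffAt ℝ 1 Φ (u x) :=
      contDiffAt_const.add (((contDiffAt_const.mul contDiffAt_id).add contDiffAt_const
        ).rpow_const_of_ne (hpos x).ne')
    exact hc.contMDiffAt.comp x (hu1 x)
  have hexp : ContMDiff (𝓡 d) 𝓘(ℝ, ℝ) 1 fun x ↦ Real.exp (-f x) :=
    (Real.contDiff_exp.comp contDiff_neg).contMDiff.comp hf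
  have hexpd : ∀ x, derivAlong (fun z ↦ Real.exp (-f z)) X x =
      -Real.exp (-f x) * derivAlong f X x := by
    intro x
    have h1 : HasDerivAt (fun s : ℝ ↦ Real.exp (-s)) (-Real.exp (-f x)) (f x) := by
      simpa using (hasDerivAt_neg (f x)).exp
    exact derivAlong_comp h1 (hf.mdifferentiable one_ne_zero x)
  have hdh : ∀ x, derivAlong (fun z ↦ Real.exp (-f z) * Φ (u z)) X x =
      Real.exp (-f x) * (Φ' (u x) * ‖X x‖ ^ 2 - Φ (u x) * derivAlong f X x) := by
    intro x
    rw [derivAlong_mul (hexp.mdifferentiable one_ne_zero x) (hΦu.mdifferentiable one_ne_zero x),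
      derivAlong_comp (hΦd x) (hu1.mdifferentiable one_ne_zero x), hexpd, derivAlong_grad_self]
    ring
  have hdiv : ∀ x, divergence X x = derivAlong f X x - u x ^ (2 * t + 1) := by
    intro x
    have h1 := hueq x
    rw [weightedLaplacian, inner_grad] at h1
    change -(divergence X x - derivAlong f X x) = _ at h1
    linarith
  -- With `h = e^{-f} Φ(u)`, the derivative of the weight cancels the drift term in `div ∇u`,
  -- leaving the integrated weighted equation.
  obtain ⟨hTint, hzero⟩ := integral_divergence_eq_zero hX (lipschitzWith_cutoff_pow o hR (k + 1))
    hχc (hexp.mul hΦu)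
  have hcont : Continuous fun x ↦ Real.exp (-f x) * u x ^ (2 * t + 1) :=
    hexp.continuous.mul (hu.continuous.rpow_const fun x ↦ Or.inr (by positivity))
  have hint1 : Integrable (fun x ↦ χ x * (Real.exp (-f x) * u x ^ (2 * t + 1))) ν :=
    (hχcont.mul hcont).integrable_of_hasCompactSupport hχc.mul_right
  have hint2 : Integrable (B.indicator fun x ↦ Real.exp (-f x)) ν :=
    ((hexp.continuous.continuousOn.integrableOn_compact
      (isCompact_closedBall o (2 * R))).mono_set Metric.ball_subset_closedBall).integrable_indicator
        Metric.isOpen_ball.measurableSet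
  have hle : ∀ x, Real.exp (-f x) * Φ (u x) * derivAlong χ X x +
      χ x * derivAlong (fun z ↦ Real.exp (-f z) * Φ (u z)) X x +
        χ x * (Real.exp (-f x) * Φ (u x)) * divergence X x ≤
      -(1 / 2) * (χ x * (Real.exp (-f x) * u x ^ (2 * t + 1))) +
        C * l ^ (-(2 * t + 1)) * B.indicator (fun x ↦ Real.exp (-f x)) x := by
    intro x
    have hD := abs_derivAlong_cutoff_pow_le (d := d) o hR (k + 1) X x
    rw [hdh, hdiv]
    by_cases hx : x ∈ B
    · have hD' : |derivAlong χ X x| ≤ R⁻¹ * (k + 2) * φ x ^ (k + 1) * ‖X x‖ := by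
        refine hD.trans_eq ?_
        push_cast
        ring
      have h1 := hpt R l hR hl0 hlR (u x) ‖X x‖ (φ x) (derivAlong χ X x) (hu0 x)
        (cutoff_nonneg o R x) (cutoff_le_one o R x) (norm_nonneg _) hD'
      rw [Set.indicator_of_mem hx]
      have h2 := mul_le_mul_of_nonneg_left h1 (Real.exp_pos (-f x)).le
      refine (le_of_eq ?_).trans (h2.trans_eq ?_)
      · simp only [χ, Φ, Φ']
        ring
      · simp only [χ]
        ring
    · have hφ : cutoff o R x = 0 := cutoff_eq_zero hR hx
      -- The bound contains `cutoff ^ (k + 1)`, so the derivative vanishes off the open ball,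
      -- including on its boundary.
      have h0 : derivAlong χ X x = 0 := by
        rw [hφ] at hD
        simpa using hD
      rw [h0, hχ0 x hx, Set.indicator_of_notMem hx]
      simp
  have hmono := integral_mono hTint ((hint1.const_mul (-(1 / 2))).add
    (hint2.const_mul (C * l ^ (-(2 * t + 1))))) hle
  rw [hzero, integral_add' (hint1.const_mul _) (hint2.const_mul _), integral_const_mul,
    integral_const_mul, integral_indicator Metric.isOpen_ball.measurableSet] at hmono
  have hμ : ∫ x in B, Real.exp (-f x) ∂ν = (weightedMeasure d f B).toReal := by
    rw [weightedMeasure, withDensity_apply _ Metric.isOpen_ball.measurableSet,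
      integral_eq_lintegral_of_nonneg_ae (ae_of_all _ fun x ↦ (Real.exp_pos _).le)
        hexp.continuous.aestronglyMeasurable]
  have hball : ∫ x in Metric.ball o R, Real.exp (-f x) * u x ^ (2 * t + 1) ∂ν ≤
      ∫ x, χ x * (Real.exp (-f x) * u x ^ (2 * t + 1)) ∂ν := by
    have hnn : ∀ x, 0 ≤ χ x * (Real.exp (-f x) * u x ^ (2 * t + 1)) := fun x ↦
      mul_nonneg (pow_nonneg (cutoff_nonneg o R x) _)
        (mul_nonneg (Real.exp_pos _).le (Real.rpow_nonneg (hu0 x) _))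
    refine le_trans (le_of_eq ?_) (setIntegral_le_integral (s := Metric.ball o R) hint1
      (ae_of_all _ hnn))
    refine setIntegral_congr_fun Metric.isOpen_ball.measurableSet fun x hx ↦ ?_
    simp [χ, φ, cutoff_eq_one hR hx]
  rw [hμ, hlC] at hmono
  linarith

end Estimate

end WeightedManifold

/-! ### Conclusion from the volume growth. -/

theorem theorem2p4 {d : ℕ} (hd : 2 ≤ d)
    {M : Type*} [MetricSpace M] [ChartedSpace (EuclideanSpace ℝ (Fin d)) M]
    [IsManifold (𝓡 d) ∞ M]
    [RiemannianBundle (fun x : M ↦ TangentSpace (𝓡 d) x)]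
    [IsContMDiffRiemannianBundle (𝓡 d) ∞ (EuclideanSpace ℝ (Fin d))
      (fun x : M ↦ TangentSpace (𝓡 d) x)]
    [IsRiemannianManifold (𝓡 d) M]
    [CompleteSpace M] [ConnectedSpace M] [NoncompactSpace M]
    [MeasurableSpace M] [BorelSpace M]
    (f : M → ℝ) (hf : ContMDiff (𝓡 d) 𝓘(ℝ, ℝ) 2 f)
    (p : ℝ) (hp : 1 < p)
    (u : M → ℝ) (hu : ContMDiff (𝓡 d) 𝓘(ℝ, ℝ) 3 u) (hu_nonneg : ∀ x, 0 ≤ u x)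
    (hu_eq : ∀ x, -WeightedManifold.weightedLaplacian d f u x = u x ^ p)
    (o : M)
    (hvol : Tendsto
      (fun R : ℝ ↦ WeightedManifold.weightedMeasure d f (Metric.ball o R) /
        ENNReal.ofReal (R ^ (2 * p / (p - 1))))
      atTop (𝓝 0)) :
    ∀ x, u x = 0 := by
  have : ProperSpace M := IsRiemannianManifold.properSpace (𝓡 d)
  have := WeightedManifold.riemannianVolume_isLocallyFinite (d := d) (M := M)
  have := WeightedManifold.riemannianVolume_isOpenPos (d := d) (M := M)
  obtain ⟨t, ht, rfl⟩ : ∃ t : ℝ, 0 < t ∧ p = 2 * t + 1 := ⟨(p - 1) / 2, by linarith, by ring⟩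
  obtain ⟨C, hC, hbound⟩ := WeightedManifold.exists_integral_le (hf.of_le (by norm_num))
    (hu.of_le (by norm_num)) hu_nonneg ht hu_eq o
  set q : ℝ := (2 * t + 1) / t with hq
  have hqeq : 2 * (2 * t + 1) / (2 * t + 1 - 1) = q := by
    rw [hq]
    field_simp
    ring
  rw [hqeq] at hvol
  set μ := WeightedManifold.weightedMeasure d f
  set F : M → ℝ := fun x ↦ Real.exp (-f x) * u x ^ (2 * t + 1)
  have hF : Continuous F := (Real.continuous_exp.comp hf.continuous.neg).mul
    (hu.continuous.rpow_const fun x ↦ Or.inr (by positivity))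
  have hF0 : ∀ x, 0 ≤ F x := fun x ↦
    mul_nonneg (Real.exp_pos _).le (Real.rpow_nonneg (hu_nonneg x) _)
  have hFint : ∀ r, IntegrableOn F (Metric.ball o r) (WeightedManifold.riemannianVolume d M) := fun r ↦
    (hF.continuousOn.integrableOn_compact (isCompact_closedBall o r)).mono_set
      Metric.ball_subset_closedBall
  -- The estimate involves `μ(B_{2R}) / R^q`, while the hypothesis at radius `2R` controls
  -- `μ(B_{2R}) / (2R)^q`; hence the factor `2 ^ q`.
  have hlim : Tendsto (fun R : ℝ ↦ C * 2 ^ q *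
      (μ (Metric.ball o (2 * R)) / ENNReal.ofReal ((2 * R) ^ q)).toReal) atTop (𝓝 0) := by
    have h1 := (ENNReal.tendsto_toReal ENNReal.zero_ne_top).comp
      (hvol.comp (tendsto_id.const_mul_atTop (two_pos : (0 : ℝ) < 2)))
    simpa using h1.const_mul (C * 2 ^ q)
  have hzero : ∀ r, ∫ x in Metric.ball o r, F x ∂(WeightedManifold.riemannianVolume d M) ≤ 0 := by
    intro r
    refine ge_of_tendsto hlim ?_
    filter_upwards [eventually_gt_atTop 0, eventually_ge_atTop r] with R hR hrR
    calc ∫ x in Metric.ball o r, F x ∂(WeightedManifold.riemannianVolume d M)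
        ≤ ∫ x in Metric.ball o R, F x ∂(WeightedManifold.riemannianVolume d M) :=
          setIntegral_mono_set (hFint R) (ae_of_all _ hF0)
            (Metric.ball_subset_ball hrR).eventuallyLE
      _ ≤ C * R ^ (-q) * (μ (Metric.ball o (2 * R))).toReal := hbound R hR
      _ = _ := by
        rw [ENNReal.toReal_div, ENNReal.toReal_ofReal (by positivity),
          Real.mul_rpow two_pos.le hR.le, Real.rpow_neg hR.le]
        have : (2 : ℝ) ^ q ≠ 0 := by positivity
        have : R ^ q ≠ 0 := by positivity
        field_simp
  intro x
  set r := dist x o + 1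
  have hint0 : ∫ x in Metric.ball o r, F x ∂(WeightedManifold.riemannianVolume d M) = 0 :=
    le_antisymm (hzero r) (integral_nonneg hF0)
  -- A nonnegative integrand of zero integral vanishes almost everywhere; as it is continuous and
  -- nonempty open sets have positive volume, it vanishes at `x`.
  have hae := (setIntegral_eq_zero_iff_of_nonneg_ae (ae_of_all _ hF0) (hFint r)).1 hint0
  have hFx : F x = 0 := Measure.eqOn_open_of_ae_eq hae Metric.isOpen_ball hF.continuousOn
    continuousOn_const (show x ∈ Metric.ball o r by simp [r])
  have h2 : u x ^ (2 * t + 1) = 0 := by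
    simpa [F, (Real.exp_pos _).ne'] using hFx
  exact (Real.rpow_eq_zero (hu_nonneg x) (by positivity)).1 h2
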